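/- Let $\mathbb H^2$ be the hyperbolic plane in the upper half-plane model, let $\mathcal G=PSL_2(\mathbb R)$ be its group of orientation-preserving isometries, let $\mathcal O=i$, and let $\partial\mathbb H^2=\mathbb R\cup\{\infty\}$ be the circle at infinity with the Möbius action of $\mathcal G$. A body is a compact connected set that is the closure of its interior. Let $\beta$ be the following binary tile. Put $\varphi(x)=\max\{0,\tfrac32(\tfrac1{10}-|x-\tfrac12|)\}$ and $\psi(y)=\max\{0,\min\{\tfrac34(y-\tfrac54),\,3(\tfrac32-y)\}\}$, and $$\beta=\{x+iy:\ \psi(y)\le x\le 1+\psi(y),\quad 1+\tfrac12(\varphi(2x)+\varphi(2x-1))\le y\le 2+\varphi(x)\}.$$ That is, $\beta$ is the region $0\le x\le1$, $1\le y\le 2$ with one triangular protrusion on its top side (pointing to $\infty$), two matching indentations in its bottom side, a triangular bump on its right side and a matching dent in its left side. A packing is a collection $P$ of copies $g\beta$ ($g\in\mathcal G$) with pairwise disjoint interiors; it is relatively dense if every copy of $\beta$ meets a body of $P$, and it is a tiling if its bodies cover $\mathbb H^2$. Let $\Sigma_\beta$ be the space of relatively dense packings, with the topology of uniform convergence on compact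 sets: $Q$ is near $P$ if, for some large $R$ and small $\varepsilon$, every body of either packing that meets the closed ball of radius $R$ about $\mathcal O$ is at Hausdorff distance less than $\varepsilon$ from a body of the other. Let $\mathcal T_\beta\subset\Sigma_\beta$ be the set of tilings. The average density of a $\mathcal G$-invariant Borel probability measure $\mu$ on $\Sigma_\beta$ is $D(\mu)=\mu\{P:\mathcal O\text{ lies in a body of }P\}$, and the optimal density is $D(\beta)=\sup_\mu D(\mu)$, over the ergodic $\mu$, i.e. the extreme points of the set of invariant Borel probability measures. Then: 1. $\beta$ is a body and it tiles $\mathbb H^2$: $\mathcal T_\beta\neq\emptyset$. 2. There is a continuous, $\mathcal G$-equivariant, surjective map $f:\mathcal T_\beta\to\partial\mathbb H^2$ that sends each tiling $T$ to the point to which the protrusion of each of its tiles points: $f(T)=g\cdot\infty$ whenever $g\beta\in T$. 3. There is no $\mathcal G$-invariant Borel probability measure on $\partial\mathbb H^2$. 4. $\mu(\mathcal T_\beta)=0$ for every $\mathcal G$-invariant Borel probability measure $\mu$ on $\Sigma_\beta$. 5. $D(\beta)<1$. -/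

import Mathlib

open UpperHalfPlane MeasureTheory
open scoped MatrixGroups Pointwise NNReal OnePoint

noncomputable section

/-! The hyperbolic plane is Mathlib's upper half-plane `ℍ` with its hyperbolic metric (curvature
`-1`). The group of orientation preserving isometries is `PSL(2, ℝ)`; everything below is expressed
through the Möbius action of `SL(2, ℝ)`, whose center acts trivially. -/

namespace HypPacking

/-- A body: a compact, connected set which is the closure of its interior. -/
structure IsBody (b : Set ℍ) : Prop where
  isCompact : IsCompact b
  isConnected : IsConnected b
  closure_interior : closure (interior b) = b

/-- `b` is a congruent copy of one of the bodies of the collection `B`. -/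
def IsCopy (B : Set (Set ℍ)) (b : Set ℍ) : Prop :=
  ∃ g : SL(2, ℝ), ∃ c ∈ B, b = g • c

theorem IsCopy.smul {B : Set (Set ℍ)} {b : Set ℍ} (h : IsCopy B b) (g : SL(2, ℝ)) :
    IsCopy B (g • b) := by
  obtain ⟨k, c, hc, rfl⟩ := h
  exact ⟨g * k, c, hc, (mul_smul g k c).symm⟩

/-- The space `Σ_B` of relatively dense packings by congruent copies of the bodies of `B`.
A packing is a *collection* of bodies (not just the union of them). -/
@[ext]
structure PackingSpace (B : Set (Set ℍ)) where
  /-- the bodies of the packing -/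
  bodies : Set (Set ℍ)
  isCopy : ∀ b ∈ bodies, IsCopy B b
  disjoint_interior : ∀ b ∈ bodies, ∀ c ∈ bodies, b ≠ c → Disjoint (interior b) (interior c)
  relativelyDense : ∀ c, IsCopy B c → ∃ b ∈ bodies, (c ∩ b).Nonempty

variable {B : Set (Set ℍ)}

/-- The natural action of the isometries on packings: move every body. -/
instance : MulAction SL(2, ℝ) (PackingSpace B) where
  smul g P :=
    { bodies := g • P.bodies
      isCopy := by
        rintro _ ⟨b, hb, rfl⟩
        exact (P.isCopy b hb).smul g
      disjoint_interior := by
        rintro _ ⟨b, hb, rfl⟩ _ ⟨c, hc, rfl⟩ hbc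
        have hne : b ≠ c := fun h => hbc (by rw [h])
        have h := P.disjoint_interior b hb c hc hne
        simpa only [interior_smul, Set.disjoint_smul_set] using h
      relativelyDense := by
        intro c hc
        obtain ⟨b, hb, hcb⟩ := P.relativelyDense (g⁻¹ • c) (hc.smul g⁻¹)
        refine ⟨g • b, Set.smul_mem_smul_set hb, ?_⟩
        have h := hcb.smul_set (a := g)
        rwa [Set.smul_set_inter, smul_inv_smul] at h }
  one_smul P := PackingSpace.ext (one_smul SL(2, ℝ) P.bodies)
  mul_smul g h P := PackingSpace.ext (mul_smul g h P.bodies)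

/-- `P` and `Q` agree up to an error `ε` on the closed ball of radius `R` about the origin `I`:
every body of either packing that meets this ball is at Hausdorff distance less than `ε` from
some body of the other packing. -/
def Close (R ε : ℝ) (P Q : PackingSpace B) : Prop :=
  (∀ b ∈ P.bodies, (b ∩ Metric.closedBall I R).Nonempty →
    ∃ c ∈ Q.bodies, Metric.hausdorffDist b c < ε) ∧
  (∀ c ∈ Q.bodies, (c ∩ Metric.closedBall I R).Nonempty →
    ∃ b ∈ P.bodies, Metric.hausdorffDist b c < ε)

theorem Close.mono {R R' ε ε' : ℝ} {P Q : PackingSpace B} (h : Close R' ε' P Q)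
    (hR : R ≤ R') (hε : ε' ≤ ε) : Close R ε P Q := by
  have hs : Metric.closedBall (I : ℍ) R ⊆ Metric.closedBall I R' :=
    Metric.closedBall_subset_closedBall hR
  refine ⟨fun b hb hne => ?_, fun c hc hne => ?_⟩
  · obtain ⟨c, hc, hlt⟩ := h.1 b hb (hne.mono (Set.inter_subset_inter_right b hs))
    exact ⟨c, hc, hlt.trans_le hε⟩
  · obtain ⟨b, hb, hlt⟩ := h.2 c hc (hne.mono (Set.inter_subset_inter_right c hs))
    exact ⟨b, hb, hlt.trans_le hε⟩

/-- The topology of uniform convergence of packings on compact subsets of the plane. -/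
instance : TopologicalSpace (PackingSpace B) where
  IsOpen U := ∀ P ∈ U, ∃ R > 0, ∃ ε > 0, ∀ Q, Close R ε P Q → Q ∈ U
  isOpen_univ := fun _ _ => ⟨1, one_pos, 1, one_pos, fun _ _ => trivial⟩
  isOpen_inter := by
    rintro U V hU hV P ⟨hPU, hPV⟩
    obtain ⟨R, hR, ε, hε, h⟩ := hU P hPU
    obtain ⟨R', -, ε', hε', h'⟩ := hV P hPV
    refine ⟨max R R', lt_max_of_lt_left hR, min ε ε', lt_min hε hε', fun Q hQ => ⟨?_, ?_⟩⟩
    · exact h Q (hQ.mono (le_max_left _ _) (min_le_left _ _))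
    · exact h' Q (hQ.mono (le_max_right _ _) (min_le_right _ _))
  isOpen_sUnion := by
    rintro S hS P ⟨U, hU, hPU⟩
    obtain ⟨R, hR, ε, hε, h⟩ := hS U hU P hPU
    exact ⟨R, hR, ε, hε, fun Q hQ => ⟨U, hU, h Q hQ⟩⟩

instance : MeasurableSpace (PackingSpace B) := borel _

instance : BorelSpace (PackingSpace B) := ⟨rfl⟩

/-- The set of points lying in some body of the packing. -/
def PackingSpace.support (P : PackingSpace B) : Set ℍ := ⋃₀ P.bodies

/-- The set of packings which are tilings, that is, which cover the whole plane. -/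
def tilings (B : Set (Set ℍ)) : Set (PackingSpace B) := {P | P.support = Set.univ}

/-- The Borel probability measures on `Σ_B` that are invariant under the isometries. -/
def invariantMeasures (B : Set (Set ℍ)) : Set (Measure (PackingSpace B)) :=
  {μ | IsProbabilityMeasure μ ∧
    ∀ (g : SL(2, ℝ)) (E : Set (PackingSpace B)), MeasurableSet E → μ (g • E) = μ E}

/-- The ergodic measures: the extreme points of the convex set of invariant measures. -/
def ergodicMeasures (B : Set (Set ℍ)) : Set (Measure (PackingSpace B)) :=
  Set.extremePoints ℝ≥0 (invariantMeasures B)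

/-- `F_p`, the indicator function of the set of packings having a body which contains `p`. -/
def covers (p : ℍ) : PackingSpace B → ℝ :=
  Set.indicator {P | p ∈ P.support} 1

/-- The average density of an (invariant) measure, taken at the origin `I`. -/
def averageDensity (μ : Measure (PackingSpace B)) : ℝ := ∫ P, covers I P ∂μ

/-- The optimal density `D(B)`. -/
def optimalDensity (B : Set (Set ℍ)) : ℝ := sSup (averageDensity '' ergodicMeasures B)

/-! The circle at infinity is `OnePoint ℝ`, with the Möbius action of `GL(2, ℝ)` restricted
to `SL(2, ℝ)`. -/

instance : MeasurableSpace (OnePoint ℝ) := borel _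

instance : BorelSpace (OnePoint ℝ) := ⟨rfl⟩

/-- A probability measure on the circle at infinity invariant under the isometries. -/
def IsInvariantAtInfinity (ν : Measure (OnePoint ℝ)) : Prop :=
  IsProbabilityMeasure ν ∧
    ∀ (g : SL(2, ℝ)) (E : Set (OnePoint ℝ)), MeasurableSet E → ν ((g : GL (Fin 2) ℝ) • E) = ν E

/-- The bump on the top side of the binary tile: the height, over the line `y = 2`, of the
triangle with vertices `(2/5, 2)`, `(3/5, 2)` and `(1/2, 43/20)`. -/
def topBump (x : ℝ) : ℝ := max 0 (3 / 2 * (1 / 10 - |x - 1 / 2|))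

/-- The bump on the right side of the binary tile: the width, beyond the line `x = 1`, of the
triangle with vertices `(1, 5/4)`, `(1, 3/2)` and `(23/20, 29/20)`. -/
def sideBump (y : ℝ) : ℝ := max 0 (min (3 / 4 * (y - 5 / 4)) (3 * (3 / 2 - y)))

/-- The binary tile `β`: the region `0 ≤ x ≤ 1`, `1 ≤ y ≤ 2` of the upper half-plane, bounded by
two geodesic and two horocyclic arcs, with a bump on its right side and the congruent dent
(translated by `-1`) in its left side, a bump on its top side (the protrusion, pointing to the
point `∞` at infinity), and the two congruent dents (images of the top bump under `z ↦ z / 2` and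
`z ↦ (z + 1) / 2`) in its bottom side, which is twice as long as the top side. -/
def binaryTile : Set ℍ :=
  {z | sideBump z.im ≤ z.re ∧ z.re ≤ 1 + sideBump z.im ∧
    1 + (topBump (2 * z.re) + topBump (2 * z.re - 1)) / 2 ≤ z.im ∧ z.im ≤ 2 + topBump z.re}

end HypPacking

end

open HypPacking

namespace HypPacking

open Filter Topology

/-! ### Limits of copies of a body -/

/-! Everything rests on rigidity (`IsRigid`): in a tiling, all tiles point to the same point at
infinity. For the binary tile this comes from matching angles. Möbius maps are conformal, so the
directions in which a copy leaves one of its points can be compared by Euclidean angles. At each of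
its points a copy contains a sector with the angle of the top bump, while the gap left at certain
reentrant vertices of a tile is narrower than two such sectors. Hence one convex vertex of a single
neighbour fills the gap exactly (`ReentrantVertex.exists_neighbour`). The angles at the tips of the
bottom and left dents and at the upper foot of the right bump each occur at only one convex vertex,
so the two tiles below and the two lateral tiles are forced. At a foot of the top bump four
candidates remain, and all of them make the tile a child of a tile above (`exists_parent_mem`). All
these neighbours differ from the tile by maps fixing `∞`. The forced descendants of a high enough
ancestor, together with their lateral neighbours, reach any given tile, whence `isRigid_binaryTile`.

The rest holds for every rigid body that tiles. The arc `[-1, 1]` and its image under `z ↦ -1 / z`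
cover the circle at infinity, while its translates by `0`, `3` and `6` are disjoint: an invariant
probability measure would give it mass at least `1/2` and at most `1/3`. Sorting tilings by the
direction of a tile through a given point, the same count shows that they form a null set.

For the density, a compactness argument (`IsRigid.exists_finset_disjoint`) shows that packings
covering a suitable finite set of points already obey the disjointness used in this count. A measure
of density `d` violates the covering condition with probability at most a constant times `1 - d`, so
the count bounds `d` away from `1` uniformly in the measure; no optimal measure has to exist. -/

/-- The point at infinity to which an isometry sends `∞`. -/
noncomputable def direction (g : SL(2, ℝ)) : OnePoint ℝ := (g : GL (Fin 2) ℝ) • (∞ : OnePoint ℝ)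

theorem direction_mul (g h : SL(2, ℝ)) :
    direction (g * h) = (g : GL (Fin 2) ℝ) • direction h := by
  simp only [direction, map_mul, mul_smul]

theorem direction_eq_ite (g : SL(2, ℝ)) :
    direction g = if g 1 0 = 0 then (∞ : OnePoint ℝ) else ((g 0 0 / g 1 0 : ℝ) : OnePoint ℝ) := by
  rw [direction, OnePoint.smul_infty_eq_ite]
  rfl

/-- Away from `∞` this is continuity of a quotient of matrix entries; only neighbourhoods of `∞`,
the complements of compact sets, need an estimate. -/
theorem continuous_direction : Continuous direction := by
  rw [continuous_iff_continuousAt]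
  intro g
  have hc : ∀ i j : Fin 2, Continuous fun h : SL(2, ℝ) => h i j := fun i j => by fun_prop
  by_cases h : g 1 0 = 0
  · have ha : g 0 0 ≠ 0 := by
      intro h0
      have := g.det_coe
      rw [Matrix.det_fin_two] at this
      simp [h0, h] at this
    rw [ContinuousAt, direction_eq_ite g, if_pos h, tendsto_iff_forall_eventually_mem]
    intro s hs
    obtain ⟨t, ⟨-, ht⟩, hts⟩ := OnePoint.hasBasis_nhds_infty.mem_iff.1 hs
    obtain ⟨M, hM⟩ := ht.isBounded.exists_norm_le
    -- The open condition `|c| * (|M| + 1) < |a|`, which holds at `g` because `c = 0` there, puts `a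
    -- / c` beyond the bound `M` of the compact set `t`.
    have hlim : Tendsto (fun h : SL(2, ℝ) => |h 1 0| * (|M| + 1) - |h 0 0|) (𝓝 g)
        (𝓝 (|g 1 0| * (|M| + 1) - |g 0 0|)) :=
      (((hc 1 0).abs.mul continuous_const).sub (hc 0 0).abs).tendsto g
    have hneg : |g 1 0| * (|M| + 1) - |g 0 0| < 0 := by
      rw [h]; simpa using ha
    filter_upwards [hlim.eventually_lt_const hneg] with k hk
    apply hts
    rw [direction_eq_ite]
    split_ifs with hk0
    · simp
    · left
      refine ⟨_, ?_, rfl⟩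
      intro hmem
      have h1 := hM _ hmem
      rw [Real.norm_eq_abs, abs_div, div_le_iff₀ (abs_pos.2 hk0)] at h1
      nlinarith [le_abs_self M, abs_pos.2 hk0]
  · have hev : ∀ᶠ k : SL(2, ℝ) in 𝓝 g, k 1 0 ≠ 0 := (hc 1 0).continuousAt.eventually_ne h
    have : ContinuousAt (fun k : SL(2, ℝ) => ((k 0 0 / k 1 0 : ℝ) : OnePoint ℝ)) g :=
      OnePoint.continuous_coe.continuousAt.comp
        ((hc 0 0).continuousAt.div (hc 1 0).continuousAt h)
    refine this.congr ?_
    filter_upwards [hev] with k hk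
    rw [direction_eq_ite, if_neg hk]

variable {b : Set ℍ} {ι : Type*}

theorem mem_smul_of_tendsto (hb : IsClosed b) {l : Filter ι} {g : ι → SL(2, ℝ)} {g₀ : SL(2, ℝ)}
    {x : ι → ℍ} {p : ℍ} (hg : Tendsto g l (𝓝 g₀)) (hx : Tendsto x l (𝓝 p))
    (h : ∃ᶠ i in l, x i ∈ g i • b) : p ∈ g₀ • b := by
  rw [Set.mem_smul_set_iff_inv_smul_mem]
  refine hb.mem_of_frequently_of_tendsto (h.mono fun i hi => ?_) (hg.inv.smul hx)
  exact Set.mem_smul_set_iff_inv_smul_mem.1 hi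

theorem eventually_mem_interior_smul {l : Filter ι} {g : ι → SL(2, ℝ)} {g₀ : SL(2, ℝ)}
    {x : ι → ℍ} {p : ℍ} (hg : Tendsto g l (𝓝 g₀)) (hx : Tendsto x l (𝓝 p))
    (h : p ∈ interior (g₀ • b)) : ∀ᶠ i in l, x i ∈ interior (g i • b) := by
  rw [interior_smul, Set.mem_smul_set_iff_inv_smul_mem] at h
  filter_upwards [(hg.inv.smul hx).eventually (isOpen_interior.mem_nhds h)] with i hi
  rw [interior_smul, Set.mem_smul_set_iff_inv_smul_mem]
  exact hi

theorem smul_eq_of_frequently_eq (hb : IsClosed b) {l : Filter ι} {g h : ι → SL(2, ℝ)}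
    {g₀ h₀ : SL(2, ℝ)} (hg : Tendsto g l (𝓝 g₀)) (hh : Tendsto h l (𝓝 h₀))
    (heq : ∃ᶠ i in l, g i • b = h i • b) : g₀ • b = h₀ • b := by
  apply Set.Subset.antisymm
  · rintro _ ⟨y, hy, rfl⟩
    refine mem_smul_of_tendsto hb hh (hg.smul_const y) (heq.mono fun i hi => ?_)
    rw [← hi]
    exact Set.smul_mem_smul_set hy
  · rintro _ ⟨y, hy, rfl⟩
    refine mem_smul_of_tendsto hb hg (hh.smul_const y) (heq.mono fun i hi => ?_)
    rw [hi]
    exact Set.smul_mem_smul_set hy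

/-- The action on `ℍ` is proper: the isometries taking some point of the compact `b` into a compact
neighbourhood of `p` form a relatively compact set. All limit arguments below draw their compactness
from here. -/
theorem exists_tendsto_of_mem_smul (hb : IsCompact b) {U : Ultrafilter ι} {g : ι → SL(2, ℝ)}
    {x : ι → ℍ} {p : ℍ} (hx : Tendsto x U (𝓝 p)) (h : ∀ᶠ i in (U : Filter ι), x i ∈ g i • b) :
    ∃ g₀, Tendsto g U (𝓝 g₀) ∧ p ∈ g₀ • b := by
  obtain ⟨K, hK, hKp⟩ := exists_compact_mem_nhds p
  have hcomp := (ProperSMul.isProperMap_smul_pair (G := SL(2, ℝ)) (X := ℍ)).isCompact_preimage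
    (hK.prod hb)
  have hmem : ∀ᶠ i in (U : Filter ι), g i ∈ Prod.fst ''
      ((fun q : SL(2, ℝ) × ℍ => (q.1 • q.2, q.2)) ⁻¹' (K ×ˢ b)) := by
    filter_upwards [h, hx.eventually hKp] with i hi hiK
    obtain ⟨y, hy, hxy⟩ := hi
    replace hxy : g i • y = x i := hxy
    refine ⟨(g i, y), ⟨?_, hy⟩, rfl⟩
    change g i • y ∈ K
    rwa [hxy]
  obtain ⟨g₀, -, hg₀⟩ := (hcomp.image continuous_fst).ultrafilter_le_nhds' (U.map g) hmem
  exact ⟨g₀, hg₀, mem_smul_of_tendsto hb.isClosed hg₀ hx h.frequently⟩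

theorem IsBody.nonempty_interior (hb : IsBody b) : (interior b).Nonempty := by
  rw [← closure_nonempty_iff, hb.closure_interior]
  exact hb.isConnected.nonempty

theorem IsBody.smul (hb : IsBody b) (g : SL(2, ℝ)) : IsBody (g • b) where
  isCompact := hb.isCompact.smul g
  isConnected := hb.isConnected.image _ (continuous_const_smul g).continuousOn
  closure_interior := by rw [interior_smul, closure_smul, hb.closure_interior]

theorem IsBody.interior_inter_nonempty (hb : IsBody b) {U : Set ℍ} (hU : IsOpen U)
    (h : (U ∩ b).Nonempty) : (U ∩ interior b).Nonempty := by
  obtain ⟨x, hxU, hxb⟩ := h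
  rw [← hb.closure_interior] at hxb
  exact mem_closure_iff.1 hxb U hU hxU

namespace PackingSpace

variable (P : PackingSpace {b})

theorem exists_smul_of_mem_bodies {c : Set ℍ} (hc : c ∈ P.bodies) : ∃ g : SL(2, ℝ), c = g • b := by
  obtain ⟨g, d, hd, rfl⟩ := P.isCopy c hc
  exact ⟨g, by rw [Set.mem_singleton_iff.1 hd]⟩

variable {P}

theorem eq_of_mem_interior {c d : Set ℍ} (hc : c ∈ P.bodies) (hd : d ∈ P.bodies) {x : ℍ}
    (hxc : x ∈ interior c) (hxd : x ∈ interior d) : c = d := by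
  by_contra h
  exact Set.disjoint_left.1 (P.disjoint_interior c hc d hd h) hxc hxd

theorem eq_of_mem_interior_of_mem (hb : IsBody b) {c d : Set ℍ} (hc : c ∈ P.bodies)
    (hd : d ∈ P.bodies) {x : ℍ} (hxc : x ∈ interior c) (hxd : x ∈ d) : c = d := by
  obtain ⟨g, rfl⟩ := P.exists_smul_of_mem_bodies hd
  obtain ⟨y, hyc, hyd⟩ := (hb.smul g).interior_inter_nonempty isOpen_interior ⟨x, hxc, hxd⟩
  exact eq_of_mem_interior hc hd hyc hyd

/-- Copies belonging to a packing do not accumulate. -/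
theorem eventually_smul_eq_of_tendsto (hb : IsBody b) {l : Filter ι} [l.NeBot]
    {g : ι → SL(2, ℝ)} {g₀ : SL(2, ℝ)} (hg : Tendsto g l (𝓝 g₀))
    (h : ∀ᶠ i in l, g i • b ∈ P.bodies) :
    g₀ • b ∈ P.bodies ∧ ∀ᶠ i in l, g i • b = g₀ • b := by
  obtain ⟨x, hx⟩ := (hb.smul g₀).nonempty_interior
  -- An interior point of the limit copy is eventually interior to the copies themselves;
  -- disjointness of interiors then makes these copies equal as sets.
  have hev := (eventually_mem_interior_smul hg tendsto_const_nhds hx).and h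
  obtain ⟨j, hj, hjP⟩ := hev.exists
  have heq : ∀ᶠ i in l, g i • b = g j • b :=
    hev.mono fun i hi => eq_of_mem_interior hi.2 hjP hi.1 hj
  have h0 : g₀ • b = g j • b :=
    smul_eq_of_frequently_eq hb.isCompact.isClosed hg tendsto_const_nhds heq.frequently
  rw [h0]
  exact ⟨hjP, heq⟩

/-- Local finiteness in usable form: bodies chosen through the points `x i` converge by properness,
hence eventually coincide with their limit. -/
theorem exists_body_of_tendsto (hb : IsBody b) {U : Ultrafilter ι} {x : ι → ℍ} {p : ℍ}
    (hx : Tendsto x U (𝓝 p)) (h : ∀ᶠ i in (U : Filter ι), x i ∈ P.support) :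
    ∃ g : SL(2, ℝ), g • b ∈ P.bodies ∧ p ∈ g • b ∧ ∀ᶠ i in (U : Filter ι), x i ∈ g • b := by
  have : ∀ i, ∃ g : SL(2, ℝ), x i ∈ P.support → g • b ∈ P.bodies ∧ x i ∈ g • b := by
    intro i
    by_cases hi : x i ∈ P.support
    · obtain ⟨c, hc, hxc⟩ := hi
      obtain ⟨g, rfl⟩ := P.exists_smul_of_mem_bodies hc
      exact ⟨g, fun _ => ⟨hc, hxc⟩⟩
    · exact ⟨1, fun h => absurd h hi⟩
  choose g hg using this
  obtain ⟨g₀, hg₀, hp⟩ := exists_tendsto_of_mem_smul hb.isCompact hx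
    (h.mono fun i hi => (hg i hi).2)
  obtain ⟨hg₀P, hev⟩ := eventually_smul_eq_of_tendsto hb hg₀ (h.mono fun i hi => (hg i hi).1)
  refine ⟨g₀, hg₀P, hp, ?_⟩
  filter_upwards [hev, h] with i hi hxi
  rw [← hi]
  exact (hg i hxi).2

theorem isClosed_support (hb : IsBody b) : IsClosed P.support := by
  rw [isClosed_iff_ultrafilter]
  intro p U hU hmem
  obtain ⟨g, hg, hp, -⟩ := exists_body_of_tendsto (P := P) hb (x := id) hU hmem
  exact ⟨_, hg, hp⟩

end PackingSpace

/-! ### Closed sets of packings and limits of packings -/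

/-- The packings by copies of `b` in which some body contains `p` and points into `J`. -/
def pointing (b : Set ℍ) (J : Set (OnePoint ℝ)) (p : ℍ) : Set (PackingSpace {b}) :=
  {P | ∃ g : SL(2, ℝ), g • b ∈ P.bodies ∧ p ∈ g • b ∧ direction g ∈ J}

theorem pointing_univ (p : ℍ) : pointing b Set.univ p = {P | p ∈ P.support} := by
  ext P
  constructor
  · rintro ⟨g, hg, hp, -⟩
    exact ⟨_, hg, hp⟩
  · rintro ⟨c, hc, hp⟩
    obtain ⟨g, rfl⟩ := P.exists_smul_of_mem_bodies hc
    exact ⟨g, hc, hp, trivial⟩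

/-- This turns invariance of a measure into equality of the masses attached to different arcs and
base points. -/
theorem smul_pointing (g : SL(2, ℝ)) (J : Set (OnePoint ℝ)) (p : ℍ) :
    g • pointing b J p = pointing b ((g : GL (Fin 2) ℝ) • J) (g • p) := by
  have key : ∀ (g : SL(2, ℝ)) (J : Set (OnePoint ℝ)) (p : ℍ),
      g • pointing b J p ⊆ pointing b ((g : GL (Fin 2) ℝ) • J) (g • p) := by
    rintro g J p _ ⟨P, ⟨h, hP, hp, hJ⟩, rfl⟩
    refine ⟨g * h, ?_, ?_, ?_⟩
    · rw [mul_smul]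
      exact Set.smul_mem_smul_set (s := P.bodies) hP
    · rw [mul_smul]
      exact Set.smul_mem_smul_set hp
    · rw [direction_mul]
      exact Set.smul_mem_smul_set hJ
  refine (key g J p).antisymm ?_
  rw [Set.subset_smul_set_iff]
  simpa only [map_inv, inv_smul_smul] using key g⁻¹ ((g : GL (Fin 2) ℝ) • J) (g • p)

/-- If `P` were a limit of packings in the set but outside it, these would supply copies through `p`
converging to some `h₀ • b`. Bodies of `P` follow them ever more closely, and bodies of `P` do not
accumulate, so `h₀ • b` belongs to `P`; its direction lies in the closed set `J`. Both measurability
and continuity of the map to the circle come from this closedness. -/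
theorem isClosed_pointing (hb : IsBody b) {J : Set (OnePoint ℝ)} (hJ : IsClosed J) (p : ℍ) :
    IsClosed (pointing b J p) := by
  rw [← isOpen_compl_iff]
  intro P hP
  by_contra hcon
  push Not at hcon
  -- A fixed radius suffices, since only bodies through `p` need to meet the ball.
  have hR : 0 < dist p I + 1 := by positivity
  have hε : ∀ n : ℕ, (0 : ℝ) < 1 / (n + 1) := fun n => Nat.one_div_pos_of_nat
  choose Q hQ hQJ using fun n : ℕ => hcon _ hR _ (hε n)
  simp only [Set.mem_compl_iff, not_not] at hQJ
  choose h hhQ hhp hhJ using hQJ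
  have hclose : ∀ n, ∃ g : SL(2, ℝ), g • b ∈ P.bodies ∧
      Metric.hausdorffDist (g • b) (h n • b) < 1 / (n + 1) := by
    intro n
    obtain ⟨c, hc, hlt⟩ := (hQ n).2 _ (hhQ n)
      ⟨p, hhp n, by rw [Metric.mem_closedBall]; linarith⟩
    obtain ⟨g, rfl⟩ := P.exists_smul_of_mem_bodies hc
    exact ⟨g, hc, hlt⟩
  choose g hgP hgh using hclose
  have hbne : ∀ k : SL(2, ℝ), (k • b).Nonempty := fun k => (hb.smul k).isConnected.nonempty
  have hbb : ∀ k : SL(2, ℝ), Bornology.IsBounded (k • b) := fun k => (hb.smul k).isCompact.isBounded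
  have hfin : ∀ n, Metric.hausdorffEDist (g n • b) (h n • b) ≠ ⊤ := fun n =>
    Metric.hausdorffEDist_ne_top_of_nonempty_of_bounded (hbne _) (hbne _) (hbb _) (hbb _)
  have hlim0 : Tendsto (fun n : ℕ => (1 : ℝ) / (n + 1)) atTop (𝓝 0) :=
    tendsto_one_div_add_atTop_nhds_zero_nat
  obtain ⟨U, hU⟩ : ∃ U : Ultrafilter ℕ, (U : Filter ℕ) ≤ atTop := ⟨_, Ultrafilter.of_le _⟩
  have hxx : ∀ x : ℕ → ℍ, ∀ q, Tendsto x U (𝓝 q) → (∀ n, x n ∈ h n • b) →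
      ∃ y : ℕ → ℍ, Tendsto y U (𝓝 q) ∧ ∀ n, y n ∈ g n • b := by
    intro x q hx hxh
    choose y hy hyd using fun n => Metric.exists_dist_lt_of_hausdorffDist_lt' (hxh n) (hgh n) (hfin n)
    refine ⟨y, ?_, hy⟩
    rw [tendsto_iff_dist_tendsto_zero] at hx ⊢
    refine squeeze_zero (fun _ => dist_nonneg) (fun n => ?_)
      (by simpa only [add_zero] using (hlim0.mono_left hU).add hx)
    exact (dist_triangle _ (x n) _).trans (add_le_add (hyd n).le le_rfl)
  obtain ⟨h₀, hh₀, hph₀⟩ := exists_tendsto_of_mem_smul hb.isCompact (U := U)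
    (tendsto_const_nhds (x := p)) (Eventually.of_forall hhp)
  obtain ⟨y, hy, hyg⟩ := hxx (fun _ => p) p tendsto_const_nhds hhp
  obtain ⟨g₀, hg₀, -⟩ := exists_tendsto_of_mem_smul hb.isCompact hy (Eventually.of_forall hyg)
  obtain ⟨hg₀P, -⟩ := PackingSpace.eventually_smul_eq_of_tendsto hb hg₀ (Eventually.of_forall hgP)
  -- The limits `g₀` and `h₀` may differ by a symmetry of `b`; only the copies are shown to be
  -- equal, and the direction is read off `h₀`.
  have hsub : h₀ • b ⊆ g₀ • b := by
    rintro _ ⟨z, hz, rfl⟩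
    obtain ⟨y, hy, hyg⟩ := hxx (fun n => h n • z) (h₀ • z) (hh₀.smul_const z)
      fun n => Set.smul_mem_smul_set hz
    exact mem_smul_of_tendsto hb.isCompact.isClosed hg₀ hy (Eventually.of_forall hyg).frequently
  have hsup : g₀ • b ⊆ h₀ • b := by
    rintro _ ⟨z, hz, rfl⟩
    have hxg : ∀ n, g n • z ∈ g n • b := fun n => Set.smul_mem_smul_set hz
    choose y hy hyd using fun n => Metric.exists_dist_lt_of_hausdorffDist_lt (hxg n) (hgh n) (hfin n)
    refine mem_smul_of_tendsto hb.isCompact.isClosed hh₀ (x := y) ?_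
      (Eventually.of_forall hy).frequently
    have hx := hg₀.smul_const z
    rw [tendsto_iff_dist_tendsto_zero] at hx ⊢
    refine squeeze_zero (fun _ => dist_nonneg) (fun n => ?_)
      (by simpa only [add_zero] using (hlim0.mono_left hU).add hx)
    refine (dist_triangle _ (g n • z) _).trans (add_le_add ?_ le_rfl)
    rw [dist_comm]
    exact (hyd n).le
  have heq := hsub.antisymm hsup
  exact hP ⟨h₀, heq ▸ hg₀P, hph₀, hJ.mem_of_tendsto ((continuous_direction.tendsto _).comp hh₀)
    (Eventually.of_forall hhJ)⟩

theorem isClosed_tilings (hb : IsBody b) : IsClosed (tilings {b}) := by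
  have : tilings {b} = ⋂ p, pointing b Set.univ p := by
    ext P
    simp only [pointing_univ, Set.mem_iInter, Set.mem_ofPred_eq, tilings, Set.eq_univ_iff_forall]
  rw [this]
  exact isClosed_iInter fun p => isClosed_pointing hb isClosed_univ p

/-- A limit along an ultrafilter of packings which eventually cover each point of a dense set is
a tiling. -/
theorem exists_tiling_of_ultrafilter (hb : IsBody b) (U : Ultrafilter ι)
    (P : ι → PackingSpace {b}) {D : Set ℍ} (hD : Dense D)
    (hcov : ∀ z ∈ D, ∀ᶠ i in (U : Filter ι), z ∈ (P i).support) :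
    ∃ T ∈ tilings {b}, ∀ (g : ι → SL(2, ℝ)) (g₀ : SL(2, ℝ)), Tendsto g U (𝓝 g₀) →
      (∀ᶠ i in (U : Filter ι), g i • b ∈ (P i).bodies) → g₀ • b ∈ T.bodies := by
  -- The bodies of the limit are the limits along `U` of bodies chosen in the `P i`. Two limits
  -- sharing an interior point come from bodies that eventually share it, hence coincide.
  let S : Set (Set ℍ) := {c | ∃ (g : ι → SL(2, ℝ)) (g₀ : SL(2, ℝ)), Tendsto g U (𝓝 g₀) ∧
      (∀ᶠ i in (U : Filter ι), g i • b ∈ (P i).bodies) ∧ c = g₀ • b}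
  have hS : ∀ z ∈ D, ∃ c ∈ S, z ∈ c := by
    intro z hz
    have : ∀ i, ∃ g : SL(2, ℝ), z ∈ (P i).support → g • b ∈ (P i).bodies ∧ z ∈ g • b := by
      intro i
      by_cases hi : z ∈ (P i).support
      · obtain ⟨c, hc, hxc⟩ := hi
        obtain ⟨g, rfl⟩ := (P i).exists_smul_of_mem_bodies hc
        exact ⟨g, fun _ => ⟨hc, hxc⟩⟩
      · exact ⟨1, fun h => absurd h hi⟩
    choose g hg using this
    obtain ⟨g₀, hg₀, hp⟩ := exists_tendsto_of_mem_smul hb.isCompact (U := U) tendsto_const_nhds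
      ((hcov z hz).mono fun i hi => (hg i hi).2)
    exact ⟨g₀ • b, ⟨g, g₀, hg₀, (hcov z hz).mono fun i hi => (hg i hi).1, rfl⟩, hp⟩
  let T : PackingSpace {b} :=
    { bodies := S
      isCopy := by
        rintro _ ⟨g, g₀, -, -, rfl⟩
        exact ⟨g₀, b, rfl, rfl⟩
      disjoint_interior := by
        rintro _ ⟨g, g₀, hg, hgP, rfl⟩ _ ⟨h, h₀, hh, hhP, rfl⟩ hne
        rw [Set.disjoint_left]
        intro x hxg hxh
        refine hne (smul_eq_of_frequently_eq hb.isCompact.isClosed hg hh (Eventually.frequently ?_))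
        filter_upwards [eventually_mem_interior_smul hg tendsto_const_nhds hxg,
          eventually_mem_interior_smul hh tendsto_const_nhds hxh, hgP, hhP] with i h1 h2 h3 h4
        exact PackingSpace.eq_of_mem_interior h3 h4 h1 h2
      relativelyDense := by
        rintro _ ⟨g, c, hc, rfl⟩
        rw [Set.mem_singleton_iff.1 hc]
        obtain ⟨z, hzg, hzD⟩ := hD.inter_open_nonempty _ isOpen_interior
          (hb.smul g).nonempty_interior
        obtain ⟨d, hd, hzd⟩ := hS z hzD
        exact ⟨d, hd, z, interior_subset hzg, hzd⟩ }
  refine ⟨T, ?_, fun g g₀ hg hgP => ⟨g, g₀, hg, hgP, rfl⟩⟩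
  have hDT : D ⊆ T.support := fun z hz => by
    obtain ⟨c, hc, hzc⟩ := hS z hz
    exact ⟨c, hc, hzc⟩
  exact Set.eq_univ_iff_forall.2 fun z =>
    (PackingSpace.isClosed_support hb).closure_subset_iff.2 hDT (hD z)

end HypPacking

namespace HypPacking

open Filter Topology

/-! ### A paradoxical arc at infinity -/

/-- The isometry `z ↦ z + x`. -/
noncomputable def translation (x : ℝ) : SL(2, ℝ) := ⟨!![1, x; 0, 1], by simp⟩

/-- The isometry `z ↦ -1 / z`. -/
noncomputable def inversion : SL(2, ℝ) := ⟨!![0, -1; 1, 0], by simp⟩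

theorem inversion_smul_I : inversion • I = I := by
  ext
  rw [coe_specialLinearGroup_apply]
  simp [inversion]

theorem toGL_smul_coe_eq_ite (g : SL(2, ℝ)) (y : ℝ) :
    (g : GL (Fin 2) ℝ) • (y : OnePoint ℝ) = if g 1 0 * y + g 1 1 = 0 then (∞ : OnePoint ℝ)
      else ((g 0 0 * y + g 0 1) / (g 1 0 * y + g 1 1) : ℝ) := by
  rw [OnePoint.smul_some_eq_ite]
  rfl

theorem translation_smul_coe (x y : ℝ) :
    (translation x : GL (Fin 2) ℝ) • (y : OnePoint ℝ) = ((y + x : ℝ) : OnePoint ℝ) := by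
  rw [toGL_smul_coe_eq_ite]
  simp [translation]

theorem inversion_smul_coe {y : ℝ} (hy : y ≠ 0) :
    (inversion : GL (Fin 2) ℝ) • (y : OnePoint ℝ) = ((-1 / y : ℝ) : OnePoint ℝ) := by
  rw [toGL_smul_coe_eq_ite]
  simp [inversion, hy]

theorem inversion_smul_zero :
    (inversion : GL (Fin 2) ℝ) • ((0 : ℝ) : OnePoint ℝ) = ∞ := by
  rw [toGL_smul_coe_eq_ite]
  simp [inversion]

/-- The arc `[-1, 1]` of the circle at infinity. -/
def centralArc : Set (OnePoint ℝ) := (↑) '' Set.Icc (-1 : ℝ) 1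

theorem isClosed_smul_centralArc (x : ℝ) :
    IsClosed ((translation x : GL (Fin 2) ℝ) • centralArc) := by
  have : (translation x : GL (Fin 2) ℝ) • centralArc =
      (fun y : ℝ => ((y + x : ℝ) : OnePoint ℝ)) '' Set.Icc (-1 : ℝ) 1 := by
    rw [← Set.image_smul, centralArc, Set.image_image]
    simp only [translation_smul_coe]
  rw [this]
  exact (isCompact_Icc.image (OnePoint.continuous_coe.comp (by fun_prop))).isClosed

theorem centralArc_union_inversion :
    centralArc ∪ (inversion : GL (Fin 2) ℝ) • centralArc = Set.univ := by
  rw [Set.eq_univ_iff_forall]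
  intro x
  induction x using OnePoint.rec with
  | infty =>
    right
    exact ⟨_, ⟨0, by norm_num, rfl⟩, inversion_smul_zero⟩
  | coe y =>
    by_cases hy : |y| ≤ 1
    · left
      exact ⟨y, abs_le.1 hy, rfl⟩
    · right
      have hy1 : 1 < |y| := not_le.1 hy
      have hy0 : y ≠ 0 := abs_pos.1 (by linarith)
      refine ⟨_, ⟨-1 / y, abs_le.1 ?_, rfl⟩, ?_⟩
      · rw [abs_div, abs_neg, abs_one, div_le_one (by linarith)]
        exact hy1.le
      · change (inversion : GL (Fin 2) ℝ) • ((-1 / y : ℝ) : OnePoint ℝ) = y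
        rw [inversion_smul_coe (by simpa using hy0)]
        congr 1
        field_simp

theorem disjoint_smul_centralArc {x y : ℝ} (h : 2 < |x - y|) :
    Disjoint ((translation x : GL (Fin 2) ℝ) • centralArc)
      ((translation y : GL (Fin 2) ℝ) • centralArc) := by
  rw [Set.disjoint_left]
  rintro _ ⟨_, ⟨s, hs, rfl⟩, rfl⟩ ⟨_, ⟨t, ht, rfl⟩, hst⟩
  simp only [translation_smul_coe, OnePoint.coe_eq_coe] at hst
  have h1 : x - y = t - s := by linarith
  rw [h1] at h
  have : |t - s| ≤ 2 := abs_le.2 ⟨by linarith [hs.2, ht.1], by linarith [hs.1, ht.2]⟩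
  linarith

theorem measureReal_add_add_le {Ω : Type*} [MeasurableSpace Ω] (μ : Measure Ω) [IsFiniteMeasure μ]
    {A : ℤ → Set Ω} {E : Set Ω} (hA : ∀ k, MeasurableSet (A k)) (hE : ∀ k, A k ⊆ E)
    (hd : ∀ k l, k ≠ l → Disjoint (A k) (A l)) :
    μ.real (A 0) + μ.real (A 1) + μ.real (A 2) ≤ μ.real E := by
  rw [← measureReal_union (hd 0 1 (by decide)) (hA 1), ← measureReal_union _ (hA 2)]
  · exact measureReal_mono (Set.union_subset (Set.union_subset (hE 0) (hE 1)) (hE 2))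
  · exact (hd 0 2 (by decide)).union_left (hd 1 2 (by decide))

/-- The central arc has length `2`, so its translates by distinct multiples of `3` are disjoint. -/
theorem two_lt_abs_sub {k l : ℤ} (h : k ≠ l) : 2 < |(3 * k : ℝ) - 3 * l| := by
  have h1 : (1 : ℝ) ≤ |(k : ℝ) - l| := by
    exact_mod_cast Int.one_le_abs (sub_ne_zero.2 h)
  rw [← mul_sub, abs_mul, abs_of_pos (by norm_num : (0 : ℝ) < 3)]
  linarith

theorem translation_zero : translation 0 = 1 := by
  ext i j
  fin_cases i <;> fin_cases j <;> simp [translation]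

theorem isClosed_centralArc : IsClosed centralArc := by
  simpa [translation_zero] using isClosed_smul_centralArc 0

/-- Two copies of the central arc cover the circle and three disjoint copies fit into it, so its
mass would be at least `1/2` and at most `1/3`. -/
theorem not_exists_isInvariantAtInfinity : ¬ ∃ ν : Measure (OnePoint ℝ), IsInvariantAtInfinity ν := by
  rintro ⟨ν, hν, hinv⟩
  have hm := isClosed_centralArc.measurableSet
  have hr : ∀ g : SL(2, ℝ), ν.real ((g : GL (Fin 2) ℝ) • centralArc) = ν.real centralArc :=
    fun g => by rw [measureReal_def, hinv g _ hm, measureReal_def]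
  have h1 := measureReal_union_le (μ := ν) centralArc ((inversion : GL (Fin 2) ℝ) • centralArc)
  rw [centralArc_union_inversion, probReal_univ, hr] at h1
  have h2 := measureReal_add_add_le ν
    (A := fun k : ℤ => (translation (3 * k) : GL (Fin 2) ℝ) • centralArc) (E := Set.univ)
    (fun k => (isClosed_smul_centralArc _).measurableSet) (fun _ => Set.subset_univ _)
    fun k l hkl => disjoint_smul_centralArc (two_lt_abs_sub hkl)
  simp only [hr, probReal_univ] at h2
  linarith

/-! ### Bodies whose tilings point to a single point at infinity -/

/-- All the bodies of a tiling by copies of `b` point to the same point at infinity. -/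
def IsRigid (b : Set ℍ) : Prop :=
  ∀ T ∈ tilings {b}, ∀ g h : SL(2, ℝ), g • b ∈ T.bodies → h • b ∈ T.bodies →
    direction g = direction h

variable {b : Set ℍ}

theorem exists_smul_mem_bodies_of_mem_tilings {T : PackingSpace {b}} (hT : T ∈ tilings {b}) (p : ℍ) :
    ∃ g : SL(2, ℝ), g • b ∈ T.bodies ∧ p ∈ g • b := by
  have hp : p ∈ T.support := by rw [show T.support = Set.univ from hT]; trivial
  obtain ⟨c, hc, hpc⟩ := hp
  obtain ⟨g, rfl⟩ := T.exists_smul_of_mem_bodies hc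
  exact ⟨g, hc, hpc⟩

theorem smul_mem_tilings {T : PackingSpace {b}} (hT : T ∈ tilings {b}) (g : SL(2, ℝ)) :
    g • T ∈ tilings {b} := by
  refine Set.eq_univ_iff_forall.2 fun z => ?_
  obtain ⟨h, hh, hz⟩ := exists_smul_mem_bodies_of_mem_tilings hT (g⁻¹ • z)
  exact ⟨g • (h • b), Set.smul_mem_smul_set (s := T.bodies) hh,
    Set.mem_smul_set_iff_inv_smul_mem.2 hz⟩

theorem smul_tilings (g : SL(2, ℝ)) : g • tilings {b} = tilings {b} := by
  apply Set.Subset.antisymm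
  · rintro _ ⟨T, hT, rfl⟩
    exact smul_mem_tilings hT g
  · intro T hT
    exact Set.mem_smul_set_iff_inv_smul_mem.2 (smul_mem_tilings hT g⁻¹)

theorem exists_direction_eq (x : OnePoint ℝ) : ∃ g : SL(2, ℝ), direction g = x := by
  induction x using OnePoint.rec with
  | infty => exact ⟨1, by simp [direction]⟩
  | coe y =>
    refine ⟨translation y * inversion, ?_⟩
    have : direction inversion = ((0 : ℝ) : OnePoint ℝ) := by
      rw [direction_eq_ite]
      simp [inversion]
    rw [direction_mul, this, translation_smul_coe, zero_add]

/-- By rigidity any tile reveals the direction. Reading it off a tile through the origin makes the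
preimage of a closed set the trace of a closed set `pointing b J I`. Surjectivity follows from
equivariance and transitivity on the circle. -/
theorem IsRigid.exists_map (hr : IsRigid b) (hb : IsBody b) (hne : (tilings {b}).Nonempty) :
    ∃ f : tilings {b} → OnePoint ℝ,
      (∀ (T : tilings {b}) (g : SL(2, ℝ)), g • b ∈ (T : PackingSpace {b}).bodies →
          f T = (g : GL (Fin 2) ℝ) • (∞ : OnePoint ℝ)) ∧
      Continuous f ∧ Function.Surjective f ∧
      ∀ (g : SL(2, ℝ)) (S T : tilings {b}),
        (S : PackingSpace {b}) = g • (T : PackingSpace {b}) →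
          f S = (g : GL (Fin 2) ℝ) • f T := by
  choose k hk hkI using fun T : tilings {b} => exists_smul_mem_bodies_of_mem_tilings T.2 I
  have hf : ∀ (T : tilings {b}) (g : SL(2, ℝ)), g • b ∈ (T : PackingSpace {b}).bodies →
      direction (k T) = direction g := fun T g hg => hr T T.2 _ _ (hk T) hg
  have heqv : ∀ (g : SL(2, ℝ)) (S T : tilings {b}),
      (S : PackingSpace {b}) = g • (T : PackingSpace {b}) →
        direction (k S) = (g : GL (Fin 2) ℝ) • direction (k T) := by
    intro g S T h
    rw [← direction_mul]
    apply hf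
    rw [h, mul_smul]
    exact Set.smul_mem_smul_set (s := (T : PackingSpace {b}).bodies) (hk T)
  refine ⟨fun T => direction (k T), hf, ?_, ?_, heqv⟩
  · refine continuous_iff_isClosed.2 fun J hJ => ?_
    have : (fun T => direction (k T)) ⁻¹' J = ((↑) : tilings {b} → _) ⁻¹' pointing b J I := by
      ext T
      constructor
      · intro h
        exact ⟨k T, hk T, hkI T, h⟩
      · rintro ⟨g, hg, -, hgJ⟩
        rwa [Set.mem_preimage, hf T g hg]
    rw [this]
    exact (isClosed_pointing hb hJ I).preimage continuous_subtype_val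
  · intro x
    obtain ⟨T, hT⟩ := hne
    obtain ⟨g, rfl⟩ := exists_direction_eq x
    refine ⟨⟨(g * (k ⟨T, hT⟩)⁻¹) • T, smul_mem_tilings hT _⟩, ?_⟩
    refine (heqv (g * (k ⟨T, hT⟩)⁻¹) ⟨_, smul_mem_tilings hT _⟩ ⟨T, hT⟩ rfl).trans ?_
    rw [← direction_mul, inv_mul_cancel_right]

theorem IsRigid.disjoint_pointing (hr : IsRigid b) {J K : Set (OnePoint ℝ)} (h : Disjoint J K)
    (p q : ℍ) : Disjoint (tilings {b} ∩ pointing b J p) (tilings {b} ∩ pointing b K q) := by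
  rw [Set.disjoint_left]
  rintro T ⟨hT, g, hg, -, hgJ⟩ ⟨-, k, hk, -, hkK⟩
  rw [hr T hT g k hg hk] at hgJ
  exact Set.disjoint_left.1 h hgJ hkK

/-- Packings covering a suitable finite set of points behave like tilings near two given points. -/
theorem IsRigid.exists_finset_disjoint (hr : IsRigid b) (hb : IsBody b) {J K : Set (OnePoint ℝ)}
    (hJ : IsClosed J) (hK : IsClosed K) (h : Disjoint J K) (p q : ℍ) :
    ∃ F : Finset ℍ, ∀ P : PackingSpace {b}, (∀ z ∈ F, z ∈ P.support) →
      P ∈ pointing b J p → P ∉ pointing b K q := by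
  by_contra hcon
  push Not at hcon
  classical
  -- The counterexample `P n` covers the first `n` points of a dense sequence; a limit is then a
  -- tiling with tiles pointing into both `J` and `K`, against rigidity.
  choose P hP hPJ hPK using fun n : ℕ =>
    hcon ((Finset.range n).image (TopologicalSpace.denseSeq ℍ))
  choose g hgP hgp hgJ using hPJ
  choose k hkP hkq hkK using hPK
  obtain ⟨U, hU⟩ : ∃ U : Ultrafilter ℕ, (U : Filter ℕ) ≤ atTop := ⟨_, Ultrafilter.of_le _⟩
  obtain ⟨T, hT, hlim⟩ := exists_tiling_of_ultrafilter hb U P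
    (TopologicalSpace.denseRange_denseSeq ℍ) (by
      rintro _ ⟨m, rfl⟩
      filter_upwards [hU (eventually_gt_atTop m)] with n hn
      exact hP n _ (Finset.mem_image_of_mem _ (Finset.mem_range.2 hn)))
  obtain ⟨g₀, hg₀, -⟩ := exists_tendsto_of_mem_smul hb.isCompact (U := U)
    (tendsto_const_nhds (x := p)) (Eventually.of_forall hgp)
  obtain ⟨k₀, hk₀, -⟩ := exists_tendsto_of_mem_smul hb.isCompact (U := U)
    (tendsto_const_nhds (x := q)) (Eventually.of_forall hkq)
  have h1 : direction g₀ ∈ J := hJ.mem_of_tendsto ((continuous_direction.tendsto _).comp hg₀)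
    (Eventually.of_forall hgJ)
  have h2 : direction k₀ ∈ K := hK.mem_of_tendsto ((continuous_direction.tendsto _).comp hk₀)
    (Eventually.of_forall hkK)
  rw [hr T hT g₀ k₀ (hlim g g₀ hg₀ (Eventually.of_forall hgP))
    (hlim k k₀ hk₀ (Eventually.of_forall hkP))] at h1
  exact Set.disjoint_left.1 h h1 h2

theorem measurableSet_pointing (hb : IsBody b) {J : Set (OnePoint ℝ)} (hJ : IsClosed J) (p : ℍ) :
    MeasurableSet (pointing b J p) :=
  (isClosed_pointing hb hJ p).measurableSet

theorem measureReal_pointing_smul (hb : IsBody b) {μ : Measure (PackingSpace {b})}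
    (hμ : μ ∈ invariantMeasures {b}) {J : Set (OnePoint ℝ)} (hJ : IsClosed J) (p : ℍ)
    (g : SL(2, ℝ)) :
    μ.real (pointing b ((g : GL (Fin 2) ℝ) • J) (g • p)) = μ.real (pointing b J p) := by
  rw [← smul_pointing, measureReal_def, hμ.2 g _ (measurableSet_pointing hb hJ p), measureReal_def]

theorem pointing_univ_subset (p : ℍ) {J K : Set (OnePoint ℝ)} (h : J ∪ K = Set.univ) :
    pointing b Set.univ p ⊆ pointing b J p ∪ pointing b K p := by
  rintro P ⟨g, hg, hp, -⟩
  rcases (Set.eq_univ_iff_forall.1 h) (direction g) with hJ | hK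
  · exact Or.inl ⟨g, hg, hp, hJ⟩
  · exact Or.inr ⟨g, hg, hp, hK⟩

/-- Let `m` be the mass of the tilings and `a` that of the tilings with a tile through the origin
pointing into the central arc. The covering gives `m ≤ 2 * a`, the disjoint translates give `3 * a ≤
m`. The base point moves along with the arc, which is harmless: by rigidity the direction does not
depend on it. -/
theorem IsRigid.measure_tilings_eq_zero (hr : IsRigid b) (hb : IsBody b)
    {μ : Measure (PackingSpace {b})} (hμ : μ ∈ invariantMeasures {b}) : μ (tilings {b}) = 0 := by
  have := hμ.1
  have hm : ∀ x : ℝ, MeasurableSet (tilings {b} ∩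
      pointing b ((translation x : GL (Fin 2) ℝ) • centralArc) (translation x • I)) := fun x =>
    (isClosed_tilings hb).measurableSet.inter
      (measurableSet_pointing hb (isClosed_smul_centralArc x) _)
  have hm0 : MeasurableSet (tilings {b} ∩ pointing b centralArc I) :=
    (isClosed_tilings hb).measurableSet.inter (measurableSet_pointing hb isClosed_centralArc _)
  have hinv : ∀ g : SL(2, ℝ), μ.real (tilings {b} ∩
      pointing b ((g : GL (Fin 2) ℝ) • centralArc) (g • I)) =
      μ.real (tilings {b} ∩ pointing b centralArc I) := by
    intro g
    rw [← smul_pointing]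
    conv_lhs => rw [← smul_tilings g]
    rw [← Set.smul_set_inter, measureReal_def, hμ.2 g _ hm0, measureReal_def]
  have h1 : μ.real (tilings {b}) ≤ 2 * μ.real (tilings {b} ∩ pointing b centralArc I) := by
    have hsub : tilings {b} ⊆ (tilings {b} ∩ pointing b centralArc I) ∪
        (tilings {b} ∩ pointing b ((inversion : GL (Fin 2) ℝ) • centralArc) (inversion • I)) := by
      intro T hT
      rw [← Set.inter_union_distrib_left, inversion_smul_I]
      obtain ⟨g, hg, hgI⟩ := exists_smul_mem_bodies_of_mem_tilings hT I
      exact ⟨hT, pointing_univ_subset I centralArc_union_inversion ⟨g, hg, hgI, trivial⟩⟩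
    have := (measureReal_mono (μ := μ) hsub).trans (measureReal_union_le _ _)
    rw [hinv] at this
    linarith
  have h2 := measureReal_add_add_le μ
    (A := fun k : ℤ => tilings {b} ∩ pointing b ((translation (3 * k) : GL (Fin 2) ℝ) • centralArc)
      (translation (3 * k) • I)) (E := tilings {b})
    (fun k => hm _) (fun _ => Set.inter_subset_left)
    fun k l hkl => hr.disjoint_pointing (disjoint_smul_centralArc (two_lt_abs_sub hkl)) _ _
  simp only [hinv] at h2
  have h3 : μ.real (tilings {b}) = 0 := le_antisymm (by linarith) measureReal_nonneg
  exact (measureReal_eq_zero_iff (by finiteness)).1 h3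

theorem averageDensity_eq (hb : IsBody b) (μ : Measure (PackingSpace {b})) :
    averageDensity μ = μ.real (pointing b Set.univ I) := by
  rw [averageDensity, pointing_univ]
  unfold covers
  rw [integral_indicator_one]
  rw [← pointing_univ]
  exact measurableSet_pointing hb isClosed_univ I

/-- For packings that cover the finite set `E` the events `A 0`, `A 1`, `A 2` exclude one another.
Each has probability at least `d / 2`, and `E` fails to be covered with probability at most `N * (1
- d)`, so `3 * d / 2 ≤ 1 + 3 * N * (1 - d)`. -/
theorem IsRigid.exists_averageDensity_le (hr : IsRigid b) (hb : IsBody b) :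
    ∃ d : ℝ, 0 ≤ d ∧ d < 1 ∧ ∀ μ ∈ invariantMeasures {b}, averageDensity μ ≤ d := by
  let A : ℤ → Set (PackingSpace {b}) := fun k =>
    pointing b ((translation (3 * k) : GL (Fin 2) ℝ) • centralArc) (translation (3 * k) • I)
  have hA : ∀ k, MeasurableSet (A k) := fun k =>
    measurableSet_pointing hb (isClosed_smul_centralArc _) _
  have hF : ∀ k l : ℤ, ∃ F : Finset ℍ, k ≠ l → ∀ P : PackingSpace {b},
      (∀ z ∈ F, z ∈ P.support) → P ∈ A k → P ∉ A l := by
    intro k l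
    by_cases hkl : k = l
    · exact ⟨∅, fun h => absurd hkl h⟩
    · obtain ⟨F, hF⟩ := hr.exists_finset_disjoint hb (isClosed_smul_centralArc (3 * k))
        (isClosed_smul_centralArc (3 * l)) (disjoint_smul_centralArc (two_lt_abs_sub hkl))
        (translation (3 * k) • I) (translation (3 * l) • I)
      exact ⟨F, fun _ => hF⟩
  choose F hF using hF
  classical
  let E : Finset ℍ := F 0 1 ∪ F 0 2 ∪ F 1 2
  let G : Set (PackingSpace {b}) := ⋂ z ∈ E, pointing b Set.univ z
  have hC : ∀ z, MeasurableSet (pointing b Set.univ z) := fun z =>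
    measurableSet_pointing hb isClosed_univ z
  have hG : MeasurableSet G := Finset.measurableSet_biInter _ fun z _ => hC z
  have hGP : ∀ P ∈ G, ∀ z ∈ E, z ∈ P.support := by
    intro P hP z hz
    have : P ∈ pointing b Set.univ z := Set.mem_iInter₂.1 hP z hz
    rwa [pointing_univ] at this
  have hdisj : ∀ k l : ℤ, k ≠ l → F k l ⊆ E → Disjoint (A k ∩ G) (A l ∩ G) := by
    intro k l hkl hE
    rw [Set.disjoint_left]
    rintro P ⟨hPk, hPG⟩ ⟨hPl, -⟩
    exact hF k l hkl P (fun z hz => hGP P hPG z (hE hz)) hPk hPl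
  let N : ℝ := E.card
  have hN : 0 ≤ N := Nat.cast_nonneg _
  -- The solution of `3 * d / 2 = 1 + 3 * N * (1 - d)`, below `1` whatever `N` is.
  refine ⟨(1 + 3 * N) / (3 / 2 + 3 * N), by positivity, ?_, ?_⟩
  · rw [div_lt_one (by positivity)]
    linarith
  intro μ hμ
  have := hμ.1
  rw [averageDensity_eq hb, le_div_iff₀ (by positivity)]
  set d := μ.real (pointing b Set.univ I) with hd
  -- The action is transitive on the plane, so every point is missed as often as the origin.
  have hcov : ∀ z, μ.real (pointing b Set.univ z)ᶜ = 1 - d := by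
    intro z
    rw [probReal_compl_eq_one_sub (hC z), hd, ← measureReal_pointing_smul hb hμ isClosed_univ I
      z.toSL2R, Set.smul_set_univ, toSL2R_smul_I]
  have hGc : μ.real Gᶜ ≤ N * (1 - d) := by
    have h1 : Gᶜ = ⋃ z ∈ E, (pointing b Set.univ z)ᶜ := by simp only [G, Set.compl_iInter]
    rw [h1]
    refine (measureReal_biUnion_finset_le E _).trans ?_
    simp only [hcov, Finset.sum_const, nsmul_eq_mul]
    exact le_rfl
  have hAeq : ∀ k, μ.real (A k) = μ.real (pointing b centralArc I) := fun k =>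
    measureReal_pointing_smul hb hμ isClosed_centralArc I _
  have hhalf : d ≤ 2 * μ.real (pointing b centralArc I) := by
    have h1 := (measureReal_mono (μ := μ)
      (pointing_univ_subset (b := b) I centralArc_union_inversion)).trans (measureReal_union_le _ _)
    have h2 := measureReal_pointing_smul hb hμ isClosed_centralArc I inversion
    rw [inversion_smul_I] at h2
    linarith
  have hAG : ∀ k, μ.real (A k) ≤ μ.real (A k ∩ G) + μ.real Gᶜ := by
    intro k
    refine (measureReal_mono ?_).trans (measureReal_union_le _ _)
    intro P hP
    by_cases hPG : P ∈ G
    · exact Or.inl ⟨hP, hPG⟩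
    · exact Or.inr hPG
  have hsum : μ.real (A 0 ∩ G) + μ.real (A 1 ∩ G) + μ.real (A 2 ∩ G) ≤ 1 := by
    have h01 := hdisj 0 1 (by decide) fun z hz => by simp [E, hz]
    have h02 := hdisj 0 2 (by decide) fun z hz => by simp [E, hz]
    have h12 := hdisj 1 2 (by decide) fun z hz => by simp [E, hz]
    rw [← measureReal_union h01 ((hA 1).inter hG),
      ← measureReal_union (h02.union_left h12) ((hA 2).inter hG)]
    exact measureReal_le_one
  have h0 := hAG 0
  have h1 := hAG 1
  have h2 := hAG 2
  rw [hAeq] at h0 h1 h2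
  linarith

theorem IsRigid.optimalDensity_lt_one (hr : IsRigid b) (hb : IsBody b) :
    optimalDensity {b} < 1 := by
  obtain ⟨d, hd0, hd1, hd⟩ := hr.exists_averageDensity_le hb
  -- `0 ≤ d` covers the case of an empty set of densities, whose `sSup` is `0`.
  refine lt_of_le_of_lt (Real.sSup_le ?_ hd0) hd1
  rintro _ ⟨μ, hμ, rfl⟩
  exact hd μ hμ.1

end HypPacking

namespace HypPacking

open Filter Topology

/-! ### The binary tile as a polygon -/

/-- The values at `z` of the affine functions which cut out the edges of the binary tile. -/
noncomputable def edgeValue (z : ℂ) : Fin 14 → ℝ :=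
  -- Indices 0–2 belong to the left side, 3–5 to the right, 6–10 to the bottom and 11–13 to the top.
  ![z.re, z.re - 3 / 4 * z.im + 15 / 16, z.re + 3 * z.im - 9 / 2,
    1 - z.re, -z.re + 3 / 4 * z.im + 1 / 16, -z.re - 3 * z.im + 11 / 2,
    z.im - 1, 3 / 2 * z.re + z.im - 29 / 20, -(3 / 2) * z.re + z.im - 7 / 10,
    3 / 2 * z.re + z.im - 11 / 5, -(3 / 2) * z.re + z.im + 1 / 20,
    2 - z.im, -(3 / 2) * z.re - z.im + 29 / 10, 3 / 2 * z.re - z.im + 7 / 5]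

/-- The linear parts of the functions `edgeValue`. -/
noncomputable def edgeSlope (v : ℂ) : Fin 14 → ℝ :=
  ![v.re, v.re - 3 / 4 * v.im, v.re + 3 * v.im,
    -v.re, -v.re + 3 / 4 * v.im, -v.re - 3 * v.im,
    v.im, 3 / 2 * v.re + v.im, -(3 / 2) * v.re + v.im,
    3 / 2 * v.re + v.im, -(3 / 2) * v.re + v.im,
    -v.im, -(3 / 2) * v.re - v.im, 3 / 2 * v.re - v.im]

/-- The monotone Boolean combination of half-planes that describes the binary tile. -/
def TileFormula (p : Fin 14 → Prop) : Prop :=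
  (p 0 ∧ (p 1 ∨ p 2)) ∧ (p 3 ∨ p 4 ∧ p 5) ∧ (p 6 ∧ (p 7 ∨ p 8) ∧ (p 9 ∨ p 10)) ∧
    (p 11 ∨ p 12 ∧ p 13)

/-- Signs can be compared edge by edge. The same formula, fed with weak, strict or first-order
signs, gives the tile, the points strictly inside, and bounds for its cones. -/
theorem TileFormula.mono {p q : Fin 14 → Prop} (hp : TileFormula p) (h : ∀ i, p i → q i) :
    TileFormula q :=
  ⟨⟨h _ hp.1.1, hp.1.2.imp (h _) (h _)⟩, hp.2.1.imp (h _) (And.imp (h _) (h _)),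
    ⟨h _ hp.2.2.1.1, hp.2.2.1.2.1.imp (h _) (h _), hp.2.2.1.2.2.imp (h _) (h _)⟩,
    hp.2.2.2.imp (h _) (And.imp (h _) (h _))⟩

theorem edgeValue_add_smul (z v : ℂ) (t : ℝ) (i : Fin 14) :
    edgeValue (z + t * v) i = edgeValue z i + t * edgeSlope v i := by
  fin_cases i <;> simp [edgeValue, edgeSlope] <;> ring

theorem continuous_edgeValue (i : Fin 14) : Continuous fun z => edgeValue z i := by
  fin_cases i <;> simp only [edgeValue] <;> simp <;> fun_prop

theorem continuous_edgeSlope (i : Fin 14) : Continuous fun v => edgeSlope v i := by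
  fin_cases i <;> simp only [edgeSlope] <;> simp <;> fun_prop

/-- The binary tile as a subset of the complex plane. -/
def tileRegion : Set ℂ := {z | TileFormula fun i => 0 ≤ edgeValue z i}

/-- The points strictly inside the binary tile. -/
def openTileRegion : Set ℂ := {z | TileFormula fun i => 0 < edgeValue z i}

theorem mem_tileRegion {z : ℂ} : z ∈ tileRegion ↔ TileFormula fun i => 0 ≤ edgeValue z i := Iff.rfl

theorem mem_openTileRegion {z : ℂ} :
    z ∈ openTileRegion ↔ TileFormula fun i => 0 < edgeValue z i := Iff.rfl

theorem topBump_eq (x : ℝ) :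
    topBump x = max 0 (min (3 / 2 * (3 / 5 - x)) (3 / 2 * (x - 2 / 5))) := by
  unfold topBump
  congr 1
  rcases le_total x (1 / 2) with h | h
  · rw [abs_of_nonpos (by linarith), min_eq_right (by linarith)]
    ring
  · rw [abs_of_nonneg (by linarith), min_eq_left (by linarith)]
    ring

theorem topBump_nonneg (x : ℝ) : 0 ≤ topBump x := le_max_left _ _

theorem topBump_le (x : ℝ) : topBump x ≤ 3 / 20 := by
  rw [topBump, max_le_iff]
  constructor
  · norm_num
  · linarith [abs_nonneg (x - 1 / 2)]

theorem sideBump_nonneg (y : ℝ) : 0 ≤ sideBump y := le_max_left _ _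

theorem sideBump_le (y : ℝ) : sideBump y ≤ 3 / 20 := by
  rw [sideBump, max_le_iff, min_le_iff]
  refine ⟨by norm_num, ?_⟩
  rcases le_total y (29 / 20) with h | h
  · left; linarith
  · right; linarith

theorem topBump_eq_zero_of_le {x : ℝ} (h : x ≤ 2 / 5) : topBump x = 0 := by
  rw [topBump_eq]
  exact max_eq_left ((min_le_right _ _).trans (by linarith))

theorem topBump_eq_zero_of_ge {x : ℝ} (h : 3 / 5 ≤ x) : topBump x = 0 := by
  rw [topBump_eq]
  exact max_eq_left ((min_le_left _ _).trans (by linarith))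

/-- The two bumps have disjoint supports, so at each `x` at most one summand is nonzero. -/
theorem bottom_le_iff (x y : ℝ) : 1 + (topBump (2 * x) + topBump (2 * x - 1)) / 2 ≤ y ↔
    1 + topBump (2 * x) / 2 ≤ y ∧ 1 + topBump (2 * x - 1) / 2 ≤ y := by
  have h1 := topBump_nonneg (2 * x)
  have h2 := topBump_nonneg (2 * x - 1)
  refine ⟨fun h => ⟨by linarith, by linarith⟩, fun ⟨h3, h4⟩ => ?_⟩
  rcases le_total x (1 / 2) with h | h
  · rw [topBump_eq_zero_of_le (x := 2 * x - 1) (by linarith)]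
    linarith
  · rw [topBump_eq_zero_of_ge (x := 2 * x) (by linarith)]
    linarith

theorem bottom_lt_iff (x y : ℝ) : 1 + (topBump (2 * x) + topBump (2 * x - 1)) / 2 < y ↔
    1 + topBump (2 * x) / 2 < y ∧ 1 + topBump (2 * x - 1) / 2 < y := by
  have h1 := topBump_nonneg (2 * x)
  have h2 := topBump_nonneg (2 * x - 1)
  refine ⟨fun h => ⟨by linarith, by linarith⟩, fun ⟨h3, h4⟩ => ?_⟩
  rcases le_total x (1 / 2) with h | h
  · rw [topBump_eq_zero_of_le (x := 2 * x - 1) (by linarith)]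
    linarith
  · rw [topBump_eq_zero_of_ge (x := 2 * x) (by linarith)]
    linarith

theorem mem_tileRegion_iff (z : ℂ) : z ∈ tileRegion ↔
    sideBump z.im ≤ z.re ∧ z.re ≤ 1 + sideBump z.im ∧
    1 + (topBump (2 * z.re) + topBump (2 * z.re - 1)) / 2 ≤ z.im ∧ z.im ≤ 2 + topBump z.re := by
  obtain ⟨x, y⟩ := z
  rw [bottom_le_iff]
  have e1 : ∀ s, 1 + topBump s / 2 ≤ y ↔ topBump s ≤ 2 * (y - 1) := fun s => by
    constructor <;> intro h <;> linarith
  rw [← sub_le_iff_le_add', ← sub_le_iff_le_add', e1, e1]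
  simp only [tileRegion, TileFormula, edgeValue, topBump_eq, sideBump, max_le_iff, min_le_iff,
    le_max_iff, le_min_iff]
  simp
  refine and_congr (and_congr Iff.rfl (or_congr ?_ ?_)) (and_congr (or_congr Iff.rfl
    (and_congr ?_ ?_)) (and_congr ?_ (or_congr Iff.rfl (and_congr ?_ ?_))))
  any_goals constructor <;> intro h <;> linarith
  constructor
  · rintro ⟨h1, h2, h3⟩
    exact ⟨⟨h1, h2.imp (fun h => by linarith) fun h => by linarith⟩,
      h1, h3.imp (fun h => by linarith) fun h => by linarith⟩
  · rintro ⟨⟨h1, h2⟩, -, h3⟩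
    exact ⟨h1, h2.imp (fun h => by linarith) fun h => by linarith,
      h3.imp (fun h => by linarith) fun h => by linarith⟩

theorem mem_openTileRegion_iff (z : ℂ) : z ∈ openTileRegion ↔
    sideBump z.im < z.re ∧ z.re < 1 + sideBump z.im ∧
    1 + (topBump (2 * z.re) + topBump (2 * z.re - 1)) / 2 < z.im ∧ z.im < 2 + topBump z.re := by
  obtain ⟨x, y⟩ := z
  rw [bottom_lt_iff]
  have e1 : ∀ s, 1 + topBump s / 2 < y ↔ topBump s < 2 * (y - 1) := fun s => by
    constructor <;> intro h <;> linarith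
  rw [← sub_lt_iff_lt_add', ← sub_lt_iff_lt_add', e1, e1]
  simp only [openTileRegion, TileFormula, edgeValue, topBump_eq, sideBump, max_lt_iff, min_lt_iff,
    lt_max_iff, lt_min_iff]
  simp
  refine and_congr (and_congr Iff.rfl (or_congr ?_ ?_)) (and_congr (or_congr Iff.rfl
    (and_congr ?_ ?_)) (and_congr ?_ (or_congr Iff.rfl (and_congr ?_ ?_))))
  any_goals constructor <;> intro h <;> linarith
  constructor
  · rintro ⟨h1, h2, h3⟩
    exact ⟨⟨h1, h2.imp (fun h => by linarith) fun h => by linarith⟩,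
      h1, h3.imp (fun h => by linarith) fun h => by linarith⟩
  · rintro ⟨⟨h1, h2⟩, -, h3⟩
    exact ⟨h1, h2.imp (fun h => by linarith) fun h => by linarith,
      h3.imp (fun h => by linarith) fun h => by linarith⟩

theorem mem_binaryTile_iff (z : ℍ) : z ∈ binaryTile ↔ (z : ℂ) ∈ tileRegion :=
  (mem_tileRegion_iff z).symm

theorem binaryTile_eq_preimage : binaryTile = ((↑) : ℍ → ℂ) ⁻¹' tileRegion :=
  Set.ext mem_binaryTile_iff

theorem isOpen_openTileRegion : IsOpen openTileRegion := by
  rw [isOpen_iff_eventually]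
  intro z hz
  have : ∀ i, ∀ᶠ w in 𝓝 z, 0 < edgeValue z i → 0 < edgeValue w i := by
    intro i
    by_cases h : 0 < edgeValue z i
    · filter_upwards [(continuous_edgeValue i).continuousAt.eventually_const_lt h] with w hw _ using hw
    · exact Eventually.of_forall fun w h' => absurd h' h
  filter_upwards [eventually_all.2 this] with w hw
  exact (mem_openTileRegion.1 hz).mono hw

theorem isClosed_tileRegion : IsClosed tileRegion := by
  rw [← isOpen_compl_iff, isOpen_iff_eventually]
  intro z hz
  have : ∀ i, ∀ᶠ w in 𝓝 z, 0 ≤ edgeValue w i → 0 ≤ edgeValue z i := by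
    intro i
    by_cases h : 0 ≤ edgeValue z i
    · exact Eventually.of_forall fun w _ => h
    · filter_upwards [(continuous_edgeValue i).continuousAt.eventually_lt_const (not_le.1 h)]
        with w hw hw' using absurd hw (not_lt.2 hw')
  filter_upwards [eventually_all.2 this] with w hw hw'
  exact hz ((mem_tileRegion.1 hw').mono hw)

theorem openTileRegion_subset : openTileRegion ⊆ tileRegion := fun _ hz =>
  (mem_openTileRegion.1 hz).mono fun _ => le_of_lt

theorem one_le_im_of_mem_tileRegion {z : ℂ} (hz : z ∈ tileRegion) : 1 ≤ z.im := by
  have := ((mem_tileRegion_iff z).1 hz).2.2.1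
  linarith [topBump_nonneg (2 * z.re), topBump_nonneg (2 * z.re - 1)]

theorem image_binaryTile : ((↑) : ℍ → ℂ) '' binaryTile = tileRegion := by
  rw [binaryTile_eq_preimage, Set.image_preimage_eq_iff]
  intro z hz
  exact ⟨⟨z, by linarith [one_le_im_of_mem_tileRegion hz]⟩, rfl⟩

/-- The tile is star-shaped about `tileCenter`. -/
noncomputable def tileCenter : ℂ := ⟨1 / 2, 3 / 2⟩

theorem edgeValue_tileCenter_pos (i : Fin 14) : 0 < edgeValue tileCenter i := by
  fin_cases i <;> simp [edgeValue, tileCenter] <;> norm_num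

/-- All edge functions are positive at the centre, so moving towards it makes every nonnegative one
positive. Both connectedness of the tile and density of its strict inside follow. -/
theorem add_mul_sub_mem_openTileRegion {z : ℂ} (hz : z ∈ tileRegion) {t : ℝ} (h0 : 0 < t)
    (h1 : t ≤ 1) : z + t * (tileCenter - z) ∈ openTileRegion := by
  refine mem_openTileRegion.2 ((mem_tileRegion.1 hz).mono fun i hi => ?_)
  have h := edgeValue_add_smul z (tileCenter - z) 1 i
  rw [Complex.ofReal_one, one_mul, one_mul, add_sub_cancel] at h
  rw [edgeValue_add_smul]
  have hc := edgeValue_tileCenter_pos i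
  rw [h] at hc
  rcases eq_or_lt_of_le h1 with rfl | h1
  · linarith
  · nlinarith [mul_nonneg (sub_nonneg.2 h1.le) hi, mul_pos h0 hc]

theorem isConnected_tileRegion : IsConnected tileRegion := by
  have hc : tileCenter ∈ tileRegion :=
    TileFormula.mono (p := fun _ => True) (by simp [TileFormula])
      fun i _ => (edgeValue_tileCenter_pos i).le
  have hs : StarConvex ℝ tileCenter tileRegion := by
    rw [starConvex_iff_segment_subset]
    intro z hz
    rw [segment_symm, segment_eq_image']
    rintro _ ⟨t, ⟨h0, h1⟩, rfl⟩
    rcases eq_or_lt_of_le h0 with rfl | h0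
    · simpa using hz
    · simpa using openTileRegion_subset (add_mul_sub_mem_openTileRegion hz h0 h1)
  exact (hs.isPathConnected hc).isConnected

theorem tileRegion_subset_closure : tileRegion ⊆ closure openTileRegion := by
  intro z hz
  have hlim : Tendsto (fun t : ℝ => z + t * (tileCenter - z)) (𝓝[>] 0) (𝓝 z) := by
    have : Continuous fun t : ℝ => z + t * (tileCenter - z) := by fun_prop
    simpa using (this.tendsto 0).mono_left nhdsWithin_le_nhds
  refine mem_closure_of_tendsto hlim ?_
  filter_upwards [Ioc_mem_nhdsGT one_pos] with t ht
  exact add_mul_sub_mem_openTileRegion hz ht.1 ht.2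

theorem binaryTile_subset_closure :
    binaryTile ⊆ closure (((↑) : ℍ → ℂ) ⁻¹' openTileRegion) := by
  rw [← isOpenEmbedding_coe.isOpenMap.preimage_closure_eq_closure_preimage continuous_coe,
    binaryTile_eq_preimage]
  exact Set.preimage_mono tileRegion_subset_closure

theorem isOpen_preimage_openTileRegion : IsOpen (((↑) : ℍ → ℂ) ⁻¹' openTileRegion) :=
  isOpen_openTileRegion.preimage continuous_coe

theorem isBody_binaryTile : IsBody binaryTile where
  isCompact := by
    rw [isEmbedding_coe.isCompact_iff, image_binaryTile]
    refine ((isCompact_Icc (a := (0 : ℝ)) (b := 2)).reProdIm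
      (isCompact_Icc (a := (1 : ℝ)) (b := 3))).of_isClosed_subset isClosed_tileRegion fun z hz => ?_
    have h1 := one_le_im_of_mem_tileRegion hz
    obtain ⟨h2, h3, -, h4⟩ := (mem_tileRegion_iff z).1 hz
    have h5 := sideBump_nonneg z.im
    have h6 := sideBump_le z.im
    have h7 := topBump_le z.re
    exact ⟨⟨by linarith, by linarith⟩, ⟨h1, by linarith⟩⟩
  isConnected := by
    have h := isConnected_tileRegion
    rw [← image_binaryTile] at h
    exact ⟨h.nonempty.of_image, (isEmbedding_coe.isInducing.isPreconnected_image).1 h.2⟩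
  closure_interior := by
    refine Set.Subset.antisymm ?_ (binaryTile_subset_closure.trans (closure_mono ?_))
    · refine closure_minimal interior_subset ?_
      rw [binaryTile_eq_preimage]
      exact isClosed_tileRegion.preimage continuous_coe
    · refine interior_maximal ?_ isOpen_preimage_openTileRegion
      rw [binaryTile_eq_preimage]
      exact Set.preimage_mono openTileRegion_subset

end HypPacking

namespace HypPacking

open Filter Topology

/-! ### The standard tiling -/

/-- The isometry `z ↦ 2 ^ m * (z + k)`. -/
noncomputable def gridMap (m k : ℤ) : SL(2, ℝ) :=
  ⟨!![√2 ^ m, √2 ^ m * k; 0, (√2 ^ m)⁻¹], by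
    rw [Matrix.det_fin_two_of, mul_zero, sub_zero, mul_inv_cancel₀ (by positivity)]⟩

theorem sqrt_two_zpow_mul_self (m : ℤ) : √2 ^ m * √2 ^ m = (2 : ℝ) ^ m := by
  rw [← mul_zpow, Real.mul_self_sqrt (by norm_num)]

theorem coe_gridMap_smul (m k : ℤ) (z : ℍ) :
    ((gridMap m k • z : ℍ) : ℂ) = ((2 : ℝ) ^ m : ℝ) * (z + k) := by
  rw [coe_specialLinearGroup_apply, ← sqrt_two_zpow_mul_self]
  simp [gridMap]
  ring

theorem gridMap_zero_zero : gridMap 0 0 = 1 := by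
  ext i j
  fin_cases i <;> fin_cases j <;> simp [gridMap]

theorem gridMap_mul_gridMap_zero (m k l : ℤ) : gridMap m k * gridMap 0 l = gridMap m (k + l) := by
  apply Subtype.ext
  change !![_, _; _, _] * !![_, _; _, _] = !![_, _; _, _]
  rw [Matrix.mul_fin_two]
  simp
  ring

/-- With `l = 0, 1`: below the tile in column `k` of a row lie columns `2 * k` and `2 * k + 1` of
the next row down. -/
theorem gridMap_mul_gridMap_neg_one (m k l : ℤ) :
    gridMap m k * gridMap (-1) l = gridMap (m - 1) (2 * k + l) := by
  apply Subtype.ext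
  change !![_, _; _, _] * !![_, _; _, _] = !![_, _; _, _]
  have h2 : √2 * √2 = 2 := Real.mul_self_sqrt (by norm_num)
  rw [Matrix.mul_fin_two, zpow_sub_one₀ (by positivity)]
  simp
  refine ⟨?_, by ring⟩
  field_simp
  linear_combination (k : ℝ) * h2

/-! ### Rows and columns of the standard tiling -/

/-- The bump on the top side of the tile, continued periodically. -/
noncomputable def periodicBump (x : ℝ) : ℝ := topBump (Int.fract x)

theorem periodicBump_nonneg (x : ℝ) : 0 ≤ periodicBump x := topBump_nonneg _

theorem periodicBump_le (x : ℝ) : periodicBump x ≤ 3 / 20 := topBump_le _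

theorem periodicBump_sub_intCast (x : ℝ) (k : ℤ) : periodicBump (x - k) = periodicBump x := by
  rw [periodicBump, Int.fract_sub_intCast, periodicBump]

theorem fract_eq_sub {x : ℝ} (k : ℤ) (h0 : k ≤ x) (h1 : x < k + 1) : Int.fract x = x - k := by
  rw [Int.fract, Int.floor_eq_iff.2 ⟨h0, h1⟩]

/-- The right bump extends the tile to `x = 23 / 20`; the next period of the top bump starts only at
`7 / 5`, so the periodic continuation does not change the tile. -/
theorem topBump_eq_periodicBump {x : ℝ} (h0 : 0 ≤ x) (h1 : x ≤ 23 / 20) :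
    topBump x = periodicBump x := by
  rw [periodicBump]
  rcases lt_or_ge x 1 with h | h
  · rw [fract_eq_sub 0 (by simpa using h0) (by simpa using h)]
    simp
  · rw [fract_eq_sub 1 (by simpa using h) (by norm_num; linarith),
      topBump_eq_zero_of_ge (by linarith), topBump_eq_zero_of_le (by norm_num; linarith)]

theorem topBump_add_eq_periodicBump {x : ℝ} (h0 : 0 ≤ x) (h1 : x ≤ 23 / 20) :
    topBump (2 * x) + topBump (2 * x - 1) = periodicBump (2 * x) := by
  rw [periodicBump]
  rcases lt_or_ge x (1 / 2) with h | h
  · rw [fract_eq_sub 0 (by norm_num; linarith) (by norm_num; linarith),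
      topBump_eq_zero_of_le (x := 2 * x - 1) (by linarith)]
    simp
  rcases lt_or_ge x 1 with h' | h'
  · rw [fract_eq_sub 1 (by norm_num; linarith) (by norm_num; linarith),
      topBump_eq_zero_of_ge (x := 2 * x) (by linarith)]
    simp
  · rw [fract_eq_sub 2 (by norm_num; linarith) (by norm_num; linarith),
      topBump_eq_zero_of_ge (x := 2 * x) (by linarith),
      topBump_eq_zero_of_ge (x := 2 * x - 1) (by linarith),
      topBump_eq_zero_of_le (by norm_num; linarith)]
    simp

/-- The curve separating the rows `m - 1` and `m` of the standard tiling. -/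
noncomputable def rowCurve (m : ℤ) (x : ℝ) : ℝ := 2 ^ m * (1 + periodicBump (2 * (x / 2 ^ m)) / 2)

theorem two_zpow_le_rowCurve (m : ℤ) (x : ℝ) : 2 ^ m ≤ rowCurve m x :=
  le_mul_of_one_le_right (by positivity) (by
    linarith [periodicBump_nonneg (2 * (x / 2 ^ m))])

theorem rowCurve_lt (m : ℤ) (x : ℝ) : rowCurve m x < 2 ^ (m + 1) := by
  rw [rowCurve, zpow_add_one₀ two_ne_zero]
  exact mul_lt_mul_of_pos_left (by
    linarith [periodicBump_le (2 * (x / 2 ^ m))]) (by positivity)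

theorem strictMono_rowCurve (x : ℝ) : StrictMono fun m => rowCurve m x :=
  strictMono_int_of_lt_succ fun m => (rowCurve_lt m x).trans_le (two_zpow_le_rowCurve _ _)

theorem rowCurve_add_one (m : ℤ) (x : ℝ) :
    rowCurve (m + 1) x = 2 ^ m * (2 + periodicBump (x / 2 ^ m)) := by
  have : 2 * (x / 2 ^ (m + 1)) = x / 2 ^ m := by
    rw [zpow_add_one₀ two_ne_zero]
    field_simp
  rw [rowCurve, this, zpow_add_one₀ two_ne_zero]
  ring

theorem mem_tileRegion_iff_periodic (z : ℂ) : z ∈ tileRegion ↔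
    sideBump z.im ≤ z.re ∧ z.re ≤ 1 + sideBump z.im ∧
    1 + periodicBump (2 * z.re) / 2 ≤ z.im ∧ z.im ≤ 2 + periodicBump z.re := by
  rw [mem_tileRegion_iff]
  refine and_congr_right fun h1 => and_congr_right fun h2 => ?_
  have h0 : 0 ≤ z.re := (sideBump_nonneg _).trans h1
  have h3 : z.re ≤ 23 / 20 := by linarith [sideBump_le z.im]
  rw [topBump_add_eq_periodicBump h0 h3, topBump_eq_periodicBump h0 h3]

theorem mem_openTileRegion_iff_periodic (z : ℂ) : z ∈ openTileRegion ↔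
    sideBump z.im < z.re ∧ z.re < 1 + sideBump z.im ∧
    1 + periodicBump (2 * z.re) / 2 < z.im ∧ z.im < 2 + periodicBump z.re := by
  rw [mem_openTileRegion_iff]
  refine and_congr_right fun h1 => and_congr_right fun h2 => ?_
  have h0 : 0 ≤ z.re := (sideBump_nonneg _).trans h1.le
  have h3 : z.re ≤ 23 / 20 := by linarith [sideBump_le z.im]
  rw [topBump_add_eq_periodicBump h0 h3, topBump_eq_periodicBump h0 h3]

theorem re_gridMap_smul (m k : ℤ) (w : ℍ) : (gridMap m k • w).re / 2 ^ m = w.re + k := by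
  have h := congrArg Complex.re (coe_gridMap_smul m k w)
  rw [Complex.re_ofReal_mul] at h
  rw [div_eq_iff (by positivity), mul_comm]
  simpa using h

theorem im_gridMap_smul (m k : ℤ) (w : ℍ) : (gridMap m k • w).im / 2 ^ m = w.im := by
  have h := congrArg Complex.im (coe_gridMap_smul m k w)
  rw [Complex.im_ofReal_mul] at h
  rw [div_eq_iff (by positivity), mul_comm]
  simpa using h

theorem periodicBump_two_mul_add (x : ℝ) (k : ℤ) :
    periodicBump (2 * (x + k)) = periodicBump (2 * x) := by
  have := periodicBump_sub_intCast (2 * (x + k)) (2 * k)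
  push_cast at this
  rw [← this]
  ring_nf

theorem periodicBump_add (x : ℝ) (k : ℤ) : periodicBump (x + k) = periodicBump x := by
  rw [← periodicBump_sub_intCast (x + k) k, add_sub_cancel_right]

theorem gridMap_smul_mem_iff (m k : ℤ) (z w : ℍ) (h : gridMap m k • w = z) :
    w ∈ binaryTile ↔ sideBump (z.im / 2 ^ m) ≤ z.re / 2 ^ m - k ∧
      z.re / 2 ^ m - k ≤ 1 + sideBump (z.im / 2 ^ m) ∧
      rowCurve m z.re ≤ z.im ∧ z.im ≤ rowCurve (m + 1) z.re := by
  subst h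
  have h2 : (0 : ℝ) < 2 ^ m := by positivity
  rw [mem_binaryTile_iff, mem_tileRegion_iff_periodic, rowCurve_add_one, rowCurve,
    ← le_div_iff₀' h2, ← div_le_iff₀' h2, re_gridMap_smul, im_gridMap_smul, add_sub_cancel_right,
    periodicBump_two_mul_add, periodicBump_add]
  rfl

theorem gridMap_smul_mem_open_iff (m k : ℤ) (z w : ℍ) (h : gridMap m k • w = z) :
    (w : ℂ) ∈ openTileRegion ↔ sideBump (z.im / 2 ^ m) < z.re / 2 ^ m - k ∧
      z.re / 2 ^ m - k < 1 + sideBump (z.im / 2 ^ m) ∧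
      rowCurve m z.re < z.im ∧ z.im < rowCurve (m + 1) z.re := by
  subst h
  have h2 : (0 : ℝ) < 2 ^ m := by positivity
  rw [mem_openTileRegion_iff_periodic, rowCurve_add_one, rowCurve,
    ← lt_div_iff₀' h2, ← div_lt_iff₀' h2, re_gridMap_smul, im_gridMap_smul, add_sub_cancel_right,
    periodicBump_two_mul_add, periodicBump_add]
  rfl

/-- The row is the dyadic level of the height, or the one below if the point lies under the lower
curve of that level; the column is a floor taken after subtracting the side bump. The bound on `2 ^
m` lets `isRigid_binaryTile` conclude that points of height below `1` lie in rows below the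
ancestor. -/
theorem exists_mem_gridMap_smul (z : ℍ) :
    ∃ m k : ℤ, z ∈ gridMap m k • binaryTile ∧ (2 : ℝ) ^ m ≤ z.im := by
  obtain ⟨n, hn1, hn2⟩ := exists_mem_Ico_zpow z.im_pos (one_lt_two (α := ℝ))
  obtain ⟨m, hm1, hm2, hm3⟩ : ∃ m : ℤ, rowCurve m z.re ≤ z.im ∧ z.im ≤ rowCurve (m + 1) z.re ∧
      (2 : ℝ) ^ m ≤ z.im := by
    rcases le_total (rowCurve n z.re) z.im with h | h
    · exact ⟨n, h, hn2.le.trans (two_zpow_le_rowCurve _ _), hn1⟩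
    · refine ⟨n - 1, ((rowCurve_lt _ _).le.trans ?_), by rwa [sub_add_cancel], ?_⟩
      · rwa [sub_add_cancel]
      · exact (zpow_le_zpow_right₀ one_le_two (by linarith)).trans hn1
  refine ⟨m, ⌊z.re / 2 ^ m - sideBump (z.im / 2 ^ m)⌋, ?_, hm3⟩
  rw [Set.mem_smul_set_iff_inv_smul_mem, gridMap_smul_mem_iff m _ z _ (smul_inv_smul _ _)]
  have h1 := Int.floor_le (z.re / 2 ^ m - sideBump (z.im / 2 ^ m))
  have h2 := Int.lt_floor_add_one (z.re / 2 ^ m - sideBump (z.im / 2 ^ m))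
  exact ⟨by linarith, by linarith, hm1, hm2⟩

/-- Density of the strict inside, used for one tile and then the other, yields a point satisfying
the strict inequalities of both. Row curves are strictly ordered, and within a row the side curves
are integer translates. -/
theorem eq_of_interior_gridMap_inter {m k n l : ℤ} {z : ℍ}
    (h1 : z ∈ interior (gridMap m k • binaryTile)) (h2 : z ∈ interior (gridMap n l • binaryTile)) :
    m = n ∧ k = l := by
  have hdense : ∀ g : SL(2, ℝ), g • binaryTile ⊆
      closure (g • ((↑) : ℍ → ℂ) ⁻¹' openTileRegion) := fun g => by
    rw [closure_smul]
    exact Set.smul_set_mono binaryTile_subset_closure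
  obtain ⟨w, hw1, hw2⟩ := mem_closure_iff.1 (hdense _ (interior_subset h1)) _
    (isOpen_interior.inter isOpen_interior) ⟨h1, h2⟩
  obtain ⟨x, ⟨-, hx2⟩, hx1⟩ := mem_closure_iff.1 (hdense _ (interior_subset hw1.2)) _
    (isOpen_interior.inter (isOpen_preimage_openTileRegion.smul (gridMap m k))) ⟨hw1.1, hw2⟩
  rw [Set.mem_smul_set_iff_inv_smul_mem, Set.mem_preimage,
    gridMap_smul_mem_open_iff _ _ x _ (smul_inv_smul _ _)] at hx1 hx2
  obtain ⟨a1, a2, a3, a4⟩ := hx1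
  obtain ⟨b1, b2, b3, b4⟩ := hx2
  have hmn : m = n := by
    have c1 := (strictMono_rowCurve x.re).lt_iff_lt.1 (a3.trans b4)
    have c2 := (strictMono_rowCurve x.re).lt_iff_lt.1 (b3.trans a4)
    omega
  subst hmn
  refine ⟨rfl, ?_⟩
  have c1 : (k : ℝ) < l + 1 := by linarith
  have c2 : (l : ℝ) < k + 1 := by linarith
  norm_cast at c1 c2
  omega

theorem tilings_binaryTile_nonempty : (tilings {binaryTile}).Nonempty := by
  refine ⟨{ bodies := {c | ∃ m k : ℤ, c = gridMap m k • binaryTile}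
            isCopy := ?_
            disjoint_interior := ?_
            relativelyDense := ?_ }, ?_⟩
  · rintro _ ⟨m, k, rfl⟩
    exact ⟨_, _, rfl, rfl⟩
  · rintro _ ⟨m, k, rfl⟩ _ ⟨n, l, rfl⟩ hne
    rw [Set.disjoint_left]
    intro z h1 h2
    obtain ⟨rfl, rfl⟩ := eq_of_interior_gridMap_inter h1 h2
    exact hne rfl
  · rintro _ ⟨g, c, hc, rfl⟩
    rw [Set.mem_singleton_iff.1 hc]
    obtain ⟨z, hz⟩ := (isBody_binaryTile.smul g).isConnected.nonempty
    obtain ⟨m, k, h, -⟩ := exists_mem_gridMap_smul z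
    exact ⟨_, ⟨m, k, rfl⟩, z, hz, h⟩
  · refine Set.eq_univ_iff_forall.2 fun z => ?_
    obtain ⟨m, k, h, -⟩ := exists_mem_gridMap_smul z
    exact ⟨_, ⟨m, k, rfl⟩, h⟩

end HypPacking

namespace HypPacking

open Filter Topology

/-! ### Cones of directions at a point -/

/-- Pairs consisting of a small positive time and a direction close to `v`. -/
noncomputable def nearDirection (v : ℂ) : Filter (ℝ × ℂ) := 𝓝[>] 0 ×ˢ 𝓝 v

instance (v : ℂ) : (nearDirection v).NeBot := by unfold nearDirection; infer_instance

/-- The directions in which one enters the interior of `s` from `p`, stably under perturbation. -/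
def inwardCone (s : Set ℍ) (p : ℍ) : Set ℂ :=
  {v | ∀ᶠ x in nearDirection v, ofComplex (p + x.1 * x.2) ∈ interior s}

/-- The directions tangent to `s` at `p` (the contingent cone). -/
def contactCone (s : Set ℍ) (p : ℍ) : Set ℂ :=
  {v | ∃ᶠ x in nearDirection v, ofComplex (p + x.1 * x.2) ∈ s}

theorem mem_inwardCone {s : Set ℍ} {p : ℍ} {v : ℂ} : v ∈ inwardCone s p ↔
    ∀ᶠ x in nearDirection v, ofComplex (p + x.1 * x.2) ∈ interior s := Iff.rfl

theorem mem_contactCone {s : Set ℍ} {p : ℍ} {v : ℂ} : v ∈ contactCone s p ↔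
    ∃ᶠ x in nearDirection v, ofComplex (p + x.1 * x.2) ∈ s := Iff.rfl

theorem inwardCone_subset_contactCone (s : Set ℍ) (p : ℍ) : inwardCone s p ⊆ contactCone s p :=
  fun _ hv => mem_contactCone.2
    ((mem_inwardCone.1 hv).frequently.mono fun _ hx => interior_subset hx)

theorem interior_inter_nonempty_of_mem_cones {s t : Set ℍ} {p : ℍ} {v : ℂ}
    (hs : v ∈ inwardCone s p) (ht : v ∈ contactCone t p) : (interior s ∩ t).Nonempty := by
  obtain ⟨x, h1, h2⟩ := ((mem_contactCone.1 ht).and_eventually (mem_inwardCone.1 hs)).exists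
  exact ⟨_, h2, h1⟩

theorem tendsto_add_mul (p v : ℂ) :
    Tendsto (fun x : ℝ × ℂ => p + x.1 * x.2) (nearDirection v) (𝓝 p) := by
  have : Continuous fun x : ℝ × ℂ => p + x.1 * x.2 := by fun_prop
  have h := this.tendsto (0, v)
  rw [nhds_prod_eq] at h
  simpa [nearDirection] using h.mono_left (prod_mono_left _ nhdsWithin_le_nhds)

theorem eventually_fst_pos (v : ℂ) : ∀ᶠ x in nearDirection v, 0 < x.1 :=
  (tendsto_fst (g := 𝓝 v)).eventually (self_mem_nhdsWithin (a := (0 : ℝ)) (s := Set.Ioi 0))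

theorem eventually_im_pos (p : ℍ) (v : ℂ) :
    ∀ᶠ x in nearDirection v, 0 < ((p : ℂ) + x.1 * x.2).im :=
  (tendsto_add_mul p v).eventually
    ((isOpen_lt continuous_const Complex.continuous_im).mem_nhds p.im_pos)

/-! ### Möbius maps act on cones through their derivative -/

/-- The denominator of the Möbius transformation `g`. -/
noncomputable def den (g : SL(2, ℝ)) (z : ℂ) : ℂ := g 1 0 * z + g 1 1

/-- The derivative at `z` of the Möbius transformation `g`. -/
noncomputable def slope (g : SL(2, ℝ)) (z : ℂ) : ℂ := (den g z ^ 2)⁻¹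

theorem den_ne_zero (g : SL(2, ℝ)) (z : ℍ) : den g z ≠ 0 := denom_ne_zero g z

theorem slope_ne_zero (g : SL(2, ℝ)) (z : ℍ) : slope g z ≠ 0 :=
  inv_ne_zero (pow_ne_zero 2 (den_ne_zero g z))

theorem coe_smul_eq (g : SL(2, ℝ)) (z : ℍ) :
    ((g • z : ℍ) : ℂ) = (g 0 0 * z + g 0 1) / den g z :=
  coe_specialLinearGroup_apply g z

theorem det_eq_one (g : SL(2, ℝ)) : g 0 0 * g 1 1 - g 0 1 * g 1 0 = 1 := by
  rw [← Matrix.det_fin_two]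
  exact g.det_coe

theorem coe_smul_sub_coe_smul (g : SL(2, ℝ)) (z p : ℍ) :
    ((g • z : ℍ) : ℂ) - (g • p : ℍ) = (z - p) / (den g z * den g p) := by
  have hd : (g 0 0 : ℂ) * g 1 1 - g 0 1 * g 1 0 = 1 := by exact_mod_cast det_eq_one g
  have h1 := den_ne_zero g z
  have h2 := den_ne_zero g p
  rw [coe_smul_eq, coe_smul_eq, div_sub_div _ _ h1 h2]
  congr 1
  simp only [den]
  linear_combination ((z : ℂ) - p) * hd

theorem slope_inv_mul_slope (g : SL(2, ℝ)) (p : ℍ) : slope g⁻¹ (g • p : ℍ) * slope g p = 1 := by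
  have hd : (g 0 0 : ℂ) * g 1 1 - g 0 1 * g 1 0 = 1 := by exact_mod_cast det_eq_one g
  have h2 := den_ne_zero g p
  have h : den g⁻¹ (g • p : ℍ) * den g p = 1 := by
    have e : den g⁻¹ (g • p : ℍ) = -g 1 0 * (g • p : ℍ) + g 0 0 := by
      simp [den, Matrix.SpecialLinearGroup.SL2_inv_expl]
    rw [e, coe_smul_eq, add_mul, mul_assoc, div_mul_cancel₀ _ h2]
    simp only [den]
    linear_combination hd
  rw [slope, slope, ← mul_inv, ← mul_pow, h]
  simp

/-- The change of time and direction effected by a Möbius transformation. -/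
noncomputable def pushDirection (g : SL(2, ℝ)) (p : ℍ) (x : ℝ × ℂ) : ℝ × ℂ :=
  (x.1, x.2 / (den g (p + x.1 * x.2) * den g p))

/-- A Möbius map bends the segment `p + t * v`, but by `coe_smul_sub_coe_smul` its image is `g • p +
t * v'` with `v'` tending to `slope g p * v`. This is why the cones allow perturbed directions: it
makes them equivariant. -/
theorem tendsto_pushDirection (g : SL(2, ℝ)) (p : ℍ) (v : ℂ) :
    Tendsto (pushDirection g p) (nearDirection v) (nearDirection (slope g p * v)) := by
  refine Tendsto.prodMk tendsto_fst ?_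
  have hden : Continuous (den g) := by unfold den; fun_prop
  have h1 : Tendsto (fun x : ℝ × ℂ => den g (p + x.1 * x.2) * den g p) (nearDirection v)
      (𝓝 (den g p * den g p)) :=
    ((hden.tendsto _).comp (tendsto_add_mul p v)).mul_const _
  have h2 : Tendsto (fun x : ℝ × ℂ => x.2) (nearDirection v) (𝓝 v) := tendsto_snd
  have h3 := h2.div h1 (mul_ne_zero (den_ne_zero g p) (den_ne_zero g p))
  have e : slope g p * v = v / (den g p * den g p) := by
    rw [slope, sq, div_eq_inv_mul]
  rw [e]
  exact h3

theorem eventually_smul_ofComplex (g : SL(2, ℝ)) (p : ℍ) (v : ℂ) :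
    ∀ᶠ x in nearDirection v, g • ofComplex (p + x.1 * x.2) =
      ofComplex ((g • p : ℍ) + (pushDirection g p x).1 * (pushDirection g p x).2) := by
  filter_upwards [eventually_im_pos p v] with x hx
  have h := coe_smul_sub_coe_smul g (ofComplex (p + x.1 * x.2)) p
  rw [ofComplex_apply_of_im_pos hx] at h ⊢
  have e : ((g • p : ℍ) : ℂ) + (pushDirection g p x).1 * (pushDirection g p x).2 =
      (g • (⟨_, hx⟩ : ℍ) : ℍ) := by
    rw [eq_add_of_sub_eq' h]
    simp only [pushDirection]
    ring
  rw [e, ofComplex_apply]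

theorem slope_mul_mem_contactCone {s : Set ℍ} {p : ℍ} {v : ℂ} (g : SL(2, ℝ))
    (h : v ∈ contactCone s p) : slope g p * v ∈ contactCone (g • s) (g • p) := by
  rw [mem_contactCone] at h ⊢
  refine (tendsto_pushDirection g p v).frequently ?_
  refine (h.and_eventually (eventually_smul_ofComplex g p v)).mono fun x hx => ?_
  rw [← hx.2]
  exact Set.smul_mem_smul_set hx.1

theorem slope_mul_mem_inwardCone_iff {s : Set ℍ} {p : ℍ} {v : ℂ} (g : SL(2, ℝ)) :
    slope g p * v ∈ inwardCone (g • s) (g • p) ↔ v ∈ inwardCone s p := by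
  have key : ∀ (s : Set ℍ) (p : ℍ) (v : ℂ) (g : SL(2, ℝ)),
      slope g p * v ∈ inwardCone (g • s) (g • p) → v ∈ inwardCone s p := by
    intro s p v g h
    rw [mem_inwardCone] at h ⊢
    filter_upwards [(tendsto_pushDirection g p v).eventually h, eventually_smul_ofComplex g p v]
      with x hx1 hx2
    rw [← hx2, interior_smul] at hx1
    exact Set.smul_mem_smul_set_iff.1 hx1
  refine ⟨key s p v g, fun h => key _ _ _ g⁻¹ ?_⟩
  rwa [← mul_assoc, slope_inv_mul_slope, one_mul, inv_smul_smul, inv_smul_smul]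

theorem slope_mul_mem_contactCone_iff {s : Set ℍ} {p : ℍ} {v : ℂ} (g : SL(2, ℝ)) :
    slope g p * v ∈ contactCone (g • s) (g • p) ↔ v ∈ contactCone s p := by
  refine ⟨fun h => ?_, slope_mul_mem_contactCone g⟩
  have := slope_mul_mem_contactCone g⁻¹ h
  rwa [← mul_assoc, slope_inv_mul_slope, one_mul, inv_smul_smul, inv_smul_smul] at this

/-- In a tiling every direction at every point is tangent to some tile. -/
theorem exists_mem_contactCone {b : Set ℍ} (hb : IsBody b) {T : PackingSpace {b}}
    (hT : T ∈ tilings {b}) (p : ℍ) (v : ℂ) :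
    ∃ g : SL(2, ℝ), g • b ∈ T.bodies ∧ p ∈ g • b ∧ v ∈ contactCone (g • b) p := by
  have hlim : Tendsto (fun t : ℝ => (t, v)) (𝓝[>] 0) (nearDirection v) :=
    Tendsto.prodMk tendsto_id tendsto_const_nhds
  obtain ⟨U, hU⟩ : ∃ U : Ultrafilter ℝ, (U : Filter ℝ) ≤ 𝓝[>] 0 := ⟨_, Ultrafilter.of_le _⟩
  have hx : Tendsto (fun t : ℝ => ofComplex ((p : ℂ) + t * v)) U (𝓝 p) := by
    have h1 : Tendsto (fun t : ℝ => (p : ℂ) + t * v) U (𝓝 p) :=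
      (tendsto_add_mul p v).comp (hlim.mono_left hU)
    have h2 : ContinuousAt ofComplex (p : ℂ) := ofComplex.continuousAt (by simp [ofComplex, p.im_pos])
    have h3 := h2.tendsto.comp h1
    rw [ofComplex_apply] at h3
    exact h3
  -- Local finiteness: one body of `T` contains `p + t * v` for times `t` tending to `0`.
  obtain ⟨g, hg, hp, hev⟩ := PackingSpace.exists_body_of_tendsto (P := T) hb hx
    (Eventually.of_forall fun t => by rw [show T.support = Set.univ from hT]; trivial)
  refine ⟨g, hg, hp, mem_contactCone.2 (hlim.frequently (f := fun t : ℝ => (t, v)) ?_)⟩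
  exact hev.frequently.filter_mono hU

end HypPacking

namespace HypPacking

open Filter Topology

/-! ### The cones of the binary tile -/

/-- An affine function with value `a` and slope `s` at `0` becomes positive to the right of `0`. -/
def LexPos (a s : ℝ) : Prop := 0 < a ∨ a = 0 ∧ 0 < s

/-- An affine function with value `a` and slope `s` at `0` is nonnegative just to the right of
`0`. -/
def LexNonneg (a s : ℝ) : Prop := 0 < a ∨ a = 0 ∧ 0 ≤ s

/-- The function `edgeValue · i` becomes positive when leaving `z` in direction `v`. -/
def EdgePos (z v : ℂ) (i : Fin 14) : Prop := LexPos (edgeValue z i) (edgeSlope v i)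

/-- The function `edgeValue · i` does not become negative, to first order, when leaving `z` in
direction `v`. -/
def EdgeNonneg (z v : ℂ) (i : Fin 14) : Prop := LexNonneg (edgeValue z i) (edgeSlope v i)

theorem tendsto_edgeSlope (v : ℂ) (i : Fin 14) :
    Tendsto (fun x : ℝ × ℂ => edgeSlope x.2 i) (nearDirection v) (𝓝 (edgeSlope v i)) :=
  ((continuous_edgeSlope i).tendsto v).comp tendsto_snd

theorem tendsto_edgeValue (z v : ℂ) (i : Fin 14) :
    Tendsto (fun x : ℝ × ℂ => edgeValue (z + x.1 * x.2) i) (nearDirection v) (𝓝 (edgeValue z i)) :=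
  ((continuous_edgeValue i).tendsto z).comp (tendsto_add_mul z v)

theorem eventually_edgeValue_pos (z v : ℂ) (i : Fin 14) :
    ∀ᶠ x in nearDirection v, EdgePos z v i → 0 < edgeValue (z + x.1 * x.2) i := by
  by_cases h : EdgePos z v i
  · rcases h with h | ⟨h0, h1⟩
    · exact ((tendsto_edgeValue z v i).eventually_const_lt h).mono fun x hx _ => hx
    · filter_upwards [eventually_fst_pos v, (tendsto_edgeSlope v i).eventually_const_lt h1]
        with x hx1 hx2 _
      rw [edgeValue_add_smul, h0, zero_add]
      exact mul_pos hx1 hx2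
  · exact Eventually.of_forall fun x hx => absurd hx h

theorem eventually_edgeNonneg (z v : ℂ) (i : Fin 14) :
    ∀ᶠ x in nearDirection v, 0 ≤ edgeValue (z + x.1 * x.2) i → EdgeNonneg z v i := by
  rcases lt_trichotomy (edgeValue z i) 0 with h | h | h
  · exact ((tendsto_edgeValue z v i).eventually_lt_const h).mono fun x hx hx' =>
      absurd hx (not_lt.2 hx')
  · by_cases h1 : 0 ≤ edgeSlope v i
    · exact Eventually.of_forall fun x _ => Or.inr ⟨h, h1⟩
    · filter_upwards [eventually_fst_pos v,
        (tendsto_edgeSlope v i).eventually_lt_const (not_le.1 h1)] with x hx1 hx2 hx3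
      rw [edgeValue_add_smul, h, zero_add] at hx3
      exact absurd (mul_neg_of_pos_of_neg hx1 hx2) (not_lt.2 hx3)
  · exact Eventually.of_forall fun x _ => Or.inl h

theorem preimage_openTileRegion_subset_interior :
    ((↑) : ℍ → ℂ) ⁻¹' openTileRegion ⊆ interior binaryTile := by
  refine interior_maximal ?_ isOpen_preimage_openTileRegion
  rw [binaryTile_eq_preimage]
  exact Set.preimage_mono openTileRegion_subset

/-- Strict first-order signs persist for small times and nearby directions, and monotonicity of the
formula transfers them. Weak signs likewise bound the contact cone from outside. -/
theorem mem_inwardCone_of_edgePos {q : ℍ} {v : ℂ} (h : TileFormula (EdgePos q v)) :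
    v ∈ inwardCone binaryTile q := by
  rw [mem_inwardCone]
  filter_upwards [eventually_all.2 (eventually_edgeValue_pos q v), eventually_im_pos q v]
    with x hx hx'
  rw [ofComplex_apply_of_im_pos hx']
  exact preimage_openTileRegion_subset_interior (mem_openTileRegion.2 (h.mono hx))

theorem edgeNonneg_of_mem_contactCone {q : ℍ} {v : ℂ} (h : v ∈ contactCone binaryTile q) :
    TileFormula (EdgeNonneg q v) := by
  obtain ⟨x, hx, hx1, hx2⟩ := ((mem_contactCone.1 h).and_eventually
    ((eventually_all.2 (eventually_edgeNonneg q v)).and (eventually_im_pos q v))).exists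
  rw [ofComplex_apply_of_im_pos hx2, mem_binaryTile_iff] at hx
  exact (mem_tileRegion.1 hx).mono hx1

/-! ### Convex and reentrant vertices of the tile -/

/-- The cross product of two vectors of the plane. -/
def cross (a b : ℂ) : ℝ := a.re * b.im - a.im * b.re

/-- The scalar product of two vectors of the plane. -/
def dot (a b : ℂ) : ℝ := a.re * b.re + a.im * b.im

/-- The convex vertices of the binary tile, with the two edge directions at them in positive
order. -/
inductive TileVertex : ℂ → ℂ → ℂ → Prop
  | topApex : TileVertex ⟨1 / 2, 43 / 20⟩ ⟨-2, -3⟩ ⟨2, -3⟩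
  | sideApex : TileVertex ⟨23 / 20, 29 / 20⟩ ⟨-3, 1⟩ ⟨-3, -4⟩
  | bottomLeft : TileVertex ⟨0, 1⟩ ⟨1, 0⟩ ⟨0, 1⟩
  | bottomRight : TileVertex ⟨1, 1⟩ ⟨0, 1⟩ ⟨-1, 0⟩
  | topRight : TileVertex ⟨1, 2⟩ ⟨-1, 0⟩ ⟨0, -1⟩
  | topLeft : TileVertex ⟨0, 2⟩ ⟨0, -1⟩ ⟨1, 0⟩
  | upperDent : TileVertex ⟨0, 3 / 2⟩ ⟨3, -1⟩ ⟨0, 1⟩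
  | lowerDent : TileVertex ⟨0, 5 / 4⟩ ⟨0, -1⟩ ⟨3, 4⟩
  | firstDent : TileVertex ⟨1 / 5, 1⟩ ⟨2, 3⟩ ⟨-1, 0⟩
  | secondDent : TileVertex ⟨3 / 10, 1⟩ ⟨1, 0⟩ ⟨-2, 3⟩
  | thirdDent : TileVertex ⟨7 / 10, 1⟩ ⟨2, 3⟩ ⟨-1, 0⟩
  | fourthDent : TileVertex ⟨4 / 5, 1⟩ ⟨1, 0⟩ ⟨-2, 3⟩

theorem TileVertex.cross_pos {q a a' : ℂ} (h : TileVertex q a a') : 0 < cross a a' := by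
  cases h <;> norm_num [cross]

/-- A definitional unfolding that exposes the explicit affine forms to arithmetic tactics. -/
theorem tileFormula_edgePos_iff (x y u w : ℝ) : TileFormula (EdgePos ⟨x, y⟩ ⟨u, w⟩) ↔
      (LexPos (x) (u) ∧ (LexPos (x - 3 / 4 * y + 15 / 16) (u - 3 / 4 * w) ∨
        LexPos (x + 3 * y - 9 / 2) (u + 3 * w))) ∧
      (LexPos (1 - x) (-u) ∨ LexPos (-x + 3 / 4 * y + 1 / 16) (-u + 3 / 4 * w) ∧
        LexPos (-x - 3 * y + 11 / 2) (-u - 3 * w)) ∧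
      (LexPos (y - 1) (w) ∧ (LexPos (3 / 2 * x + y - 29 / 20) (3 / 2 * u + w) ∨
        LexPos (-(3 / 2) * x + y - 7 / 10) (-(3 / 2) * u + w)) ∧ (LexPos (3 / 2 * x + y - 11 / 5) (3 / 2 * u + w) ∨
        LexPos (-(3 / 2) * x + y + 1 / 20) (-(3 / 2) * u + w))) ∧
      (LexPos (2 - y) (-w) ∨ LexPos (-(3 / 2) * x - y + 29 / 10) (-(3 / 2) * u - w) ∧
        LexPos (3 / 2 * x - y + 7 / 5) (3 / 2 * u - w)) := Iff.rfl

theorem tileFormula_edgeNonneg_iff (x y u w : ℝ) : TileFormula (EdgeNonneg ⟨x, y⟩ ⟨u, w⟩) ↔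
      (LexNonneg (x) (u) ∧ (LexNonneg (x - 3 / 4 * y + 15 / 16) (u - 3 / 4 * w) ∨
        LexNonneg (x + 3 * y - 9 / 2) (u + 3 * w))) ∧
      (LexNonneg (1 - x) (-u) ∨ LexNonneg (-x + 3 / 4 * y + 1 / 16) (-u + 3 / 4 * w) ∧
        LexNonneg (-x - 3 * y + 11 / 2) (-u - 3 * w)) ∧
      (LexNonneg (y - 1) (w) ∧ (LexNonneg (3 / 2 * x + y - 29 / 20) (3 / 2 * u + w) ∨
        LexNonneg (-(3 / 2) * x + y - 7 / 10) (-(3 / 2) * u + w)) ∧ (LexNonneg (3 / 2 * x + y - 11 / 5) (3 / 2 * u + w) ∨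
        LexNonneg (-(3 / 2) * x + y + 1 / 20) (-(3 / 2) * u + w))) ∧
      (LexNonneg (2 - y) (-w) ∨ LexNonneg (-(3 / 2) * x - y + 29 / 10) (-(3 / 2) * u - w) ∧
        LexNonneg (3 / 2 * x - y + 7 / 5) (3 / 2 * u - w)) := Iff.rfl

theorem TileVertex.edgePos {q a a' v : ℂ} (h : TileVertex q a a') (h1 : 0 < cross a v)
    (h2 : 0 < cross v a') : TileFormula (EdgePos q v) := by
  obtain ⟨u, w⟩ := v
  cases h <;> norm_num [cross] at h1 h2 <;> rw [tileFormula_edgePos_iff] <;>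
    norm_num [LexPos] <;> constructor <;> linarith

theorem TileVertex.of_edgeNonneg {q a a' v : ℂ} (h : TileVertex q a a')
    (hv : TileFormula (EdgeNonneg q v)) : 0 ≤ cross a v ∧ 0 ≤ cross v a' := by
  obtain ⟨u, w⟩ := v
  cases h <;> rw [tileFormula_edgeNonneg_iff] at hv <;> norm_num [LexNonneg] at hv <;>
    norm_num [cross] <;> constructor <;> linarith [hv.1, hv.2]
theorem tileFormula_edgeValue_iff (x y : ℝ) :
    (TileFormula fun i => 0 ≤ edgeValue ⟨x, y⟩ i) ↔
      (0 ≤ x ∧ (0 ≤ x - 3 / 4 * y + 15 / 16 ∨ 0 ≤ x + 3 * y - 9 / 2)) ∧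
      (0 ≤ 1 - x ∨ 0 ≤ -x + 3 / 4 * y + 1 / 16 ∧ 0 ≤ -x - 3 * y + 11 / 2) ∧
      (0 ≤ y - 1 ∧ (0 ≤ 3 / 2 * x + y - 29 / 20 ∨ 0 ≤ -(3 / 2) * x + y - 7 / 10) ∧
        (0 ≤ 3 / 2 * x + y - 11 / 5 ∨ 0 ≤ -(3 / 2) * x + y + 1 / 20)) ∧
      (0 ≤ 2 - y ∨ 0 ≤ -(3 / 2) * x - y + 29 / 10 ∧ 0 ≤ 3 / 2 * x - y + 7 / 5) := Iff.rfl

/-- Either `z` is a convex vertex of the tile, or all the directions of some open half-plane lead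
from `z` into the interior of the tile. -/
def HasVertexOrHalfPlane (z : ℂ) : Prop :=
  (∃ a a', TileVertex z a a') ∨
    ∃ n : ℂ, n ≠ 0 ∧ ∀ v, 0 < dot n v → TileFormula (EdgePos z v)

/-- Corners and mouths of the dent are convex vertices. Inside the dent the formula is a
disjunction, so one tight edge already provides a half-plane, even at the tip. -/
theorem hasVertexOrHalfPlane_of_left {x y : ℝ} (hz : TileFormula fun i => 0 ≤ edgeValue ⟨x, y⟩ i)
    (h : ¬(0 < x ∧ (0 < x - 3 / 4 * y + 15 / 16 ∨ 0 < x + 3 * y - 9 / 2))) :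
    HasVertexOrHalfPlane ⟨x, y⟩ := by
  rw [tileFormula_edgeValue_iff] at hz
  obtain ⟨⟨h0, h12⟩, -, ⟨h6, -, -⟩, h11⟩ := hz
  rcases h0.eq_or_lt with rfl | h0
  · have hy2 : y ≤ 2 := by rcases h11 with h | ⟨-, h⟩ <;> linarith
    rcases (sub_nonneg.1 h6).eq_or_lt with rfl | hy1
    · exact Or.inl ⟨_, _, .bottomLeft⟩
    rcases hy2.eq_or_lt with rfl | hy2
    · exact Or.inl ⟨_, _, .topLeft⟩
    by_cases h5 : y = 5 / 4
    · subst h5; exact Or.inl ⟨_, _, .lowerDent⟩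
    by_cases h3 : y = 3 / 2
    · subst h3; exact Or.inl ⟨_, _, .upperDent⟩
    have h12' : 0 < 0 - 3 / 4 * y + 15 / 16 ∨ 0 < 0 + 3 * y - 9 / 2 := by
      rcases h12 with h | h
      · exact Or.inl (lt_of_le_of_ne h fun e => h5 (by linarith))
      · exact Or.inr (lt_of_le_of_ne h fun e => h3 (by linarith))
    refine Or.inr ⟨⟨1, 0⟩, by simp [Complex.ext_iff], fun ⟨u, w⟩ hv => ?_⟩
    norm_num [dot] at hv
    rw [tileFormula_edgePos_iff]
    exact ⟨⟨Or.inr ⟨rfl, by linarith⟩, h12'.imp Or.inl Or.inl⟩, Or.inl (Or.inl (by linarith)),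
        ⟨Or.inl (by linarith), Or.inr (Or.inl (by linarith)), Or.inr (Or.inl (by linarith))⟩, Or.inl (Or.inl (by linarith))⟩
  · have h1 : x - 3 / 4 * y + 15 / 16 ≤ 0 := not_lt.1 fun h' => h ⟨h0, Or.inl h'⟩
    have h2 : x + 3 * y - 9 / 2 ≤ 0 := not_lt.1 fun h' => h ⟨h0, Or.inr h'⟩
    rcases h12 with h' | h'
    · refine Or.inr ⟨⟨1, -(3 / 4)⟩, by simp [Complex.ext_iff], fun ⟨u, w⟩ hv => ?_⟩
      norm_num [dot] at hv
      rw [tileFormula_edgePos_iff]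
      exact ⟨⟨Or.inl (by linarith), Or.inl (Or.inr ⟨by linarith, by linarith⟩)⟩, Or.inl (Or.inl (by linarith)),
        ⟨Or.inl (by linarith), Or.inr (Or.inl (by linarith)), Or.inr (Or.inl (by linarith))⟩, Or.inl (Or.inl (by linarith))⟩
    · refine Or.inr ⟨⟨1, 3⟩, by simp [Complex.ext_iff], fun ⟨u, w⟩ hv => ?_⟩
      norm_num [dot] at hv
      rw [tileFormula_edgePos_iff]
      exact ⟨⟨Or.inl (by linarith), Or.inr (Or.inr ⟨by linarith, by linarith⟩)⟩, Or.inl (Or.inl (by linarith)),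
        ⟨Or.inl (by linarith), Or.inr (Or.inl (by linarith)), Or.inr (Or.inl (by linarith))⟩, Or.inl (Or.inl (by linarith))⟩

theorem hasVertexOrHalfPlane_of_right {x y : ℝ} (hz : TileFormula fun i => 0 ≤ edgeValue ⟨x, y⟩ i)
    (h : ¬(0 < 1 - x ∨ 0 < -x + 3 / 4 * y + 1 / 16 ∧ 0 < -x - 3 * y + 11 / 2)) :
    HasVertexOrHalfPlane ⟨x, y⟩ := by
  rw [tileFormula_edgeValue_iff] at hz
  obtain ⟨-, h345, ⟨h6, -, -⟩, h11⟩ := hz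
  have hx : 1 ≤ x := not_lt.1 fun h' => h (Or.inl (by linarith))
  have hy2 : y ≤ 2 := by rcases h11 with h | ⟨h, -⟩ <;> linarith
  rcases hx.eq_or_lt with rfl | hx
  · rcases (sub_nonneg.1 h6).eq_or_lt with rfl | hy1
    · exact Or.inl ⟨_, _, .bottomRight⟩
    rcases hy2.eq_or_lt with rfl | hy2
    · exact Or.inl ⟨_, _, .topRight⟩
    refine Or.inr ⟨⟨-1, 0⟩, by simp [Complex.ext_iff], fun ⟨u, w⟩ hv => ?_⟩
    norm_num [dot] at hv
    rw [tileFormula_edgePos_iff]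
    exact ⟨⟨Or.inl (by linarith), Or.inl (Or.inl (by linarith))⟩, Or.inl (Or.inr ⟨by linarith, by linarith⟩),
        ⟨Or.inl (by linarith), Or.inl (Or.inl (by linarith)), Or.inl (Or.inl (by linarith))⟩, Or.inl (Or.inl (by linarith))⟩
  · obtain ⟨h4, h5⟩ : 0 ≤ -x + 3 / 4 * y + 1 / 16 ∧ 0 ≤ -x - 3 * y + 11 / 2 :=
      h345.resolve_left (by linarith)
    rcases h4.eq_or_lt with h4 | h4
    · rcases h5.eq_or_lt with h5 | h5
      · obtain rfl : x = 23 / 20 := by linarith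
        obtain rfl : y = 29 / 20 := by linarith
        exact Or.inl ⟨_, _, .sideApex⟩
      · refine Or.inr ⟨⟨-1, 3 / 4⟩, by simp [Complex.ext_iff], fun ⟨u, w⟩ hv => ?_⟩
        norm_num [dot] at hv
        rw [tileFormula_edgePos_iff]
        exact ⟨⟨Or.inl (by linarith), Or.inl (Or.inl (by linarith))⟩, Or.inr (⟨Or.inr ⟨by linarith, by linarith⟩, Or.inl (by linarith)⟩),
        ⟨Or.inl (by linarith), Or.inl (Or.inl (by linarith)), Or.inl (Or.inl (by linarith))⟩, Or.inl (Or.inl (by linarith))⟩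
    · have h5' : -x - 3 * y + 11 / 2 = 0 :=
        le_antisymm (not_lt.1 fun h' => h (Or.inr ⟨h4, h'⟩)) h5
      refine Or.inr ⟨⟨-1, -3⟩, by simp [Complex.ext_iff], fun ⟨u, w⟩ hv => ?_⟩
      norm_num [dot] at hv
      rw [tileFormula_edgePos_iff]
      exact ⟨⟨Or.inl (by linarith), Or.inl (Or.inl (by linarith))⟩, Or.inr (⟨Or.inl (by linarith), Or.inr ⟨by linarith, by linarith⟩⟩),
        ⟨Or.inl (by linarith), Or.inl (Or.inl (by linarith)), Or.inl (Or.inl (by linarith))⟩, Or.inl (Or.inl (by linarith))⟩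

theorem hasVertexOrHalfPlane_of_bottom {x y : ℝ}
    (hz : TileFormula fun i => 0 ≤ edgeValue ⟨x, y⟩ i)
    (h : ¬(0 < y - 1 ∧ (0 < 3 / 2 * x + y - 29 / 20 ∨ 0 < -(3 / 2) * x + y - 7 / 10) ∧
      (0 < 3 / 2 * x + y - 11 / 5 ∨ 0 < -(3 / 2) * x + y + 1 / 20))) :
    HasVertexOrHalfPlane ⟨x, y⟩ := by
  rw [tileFormula_edgeValue_iff] at hz
  obtain ⟨⟨h0, -⟩, h345, ⟨h6, h78, h910⟩, -⟩ := hz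
  rcases (sub_nonneg.1 h6).eq_or_lt with rfl | hy
  · have hx1 : x ≤ 1 := by rcases h345 with h | ⟨h, -⟩ <;> linarith
    rcases h0.eq_or_lt with rfl | h0
    · exact Or.inl ⟨_, _, .bottomLeft⟩
    rcases hx1.eq_or_lt with rfl | hx1
    · exact Or.inl ⟨_, _, .bottomRight⟩
    by_cases e1 : x = 1 / 5
    · subst e1; exact Or.inl ⟨_, _, .firstDent⟩
    by_cases e2 : x = 3 / 10
    · subst e2; exact Or.inl ⟨_, _, .secondDent⟩
    by_cases e3 : x = 7 / 10
    · subst e3; exact Or.inl ⟨_, _, .thirdDent⟩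
    by_cases e4 : x = 4 / 5
    · subst e4; exact Or.inl ⟨_, _, .fourthDent⟩
    have h78' : 0 < 3 / 2 * x + 1 - 29 / 20 ∨ 0 < -(3 / 2) * x + 1 - 7 / 10 := by
      rcases h78 with h | h
      · exact Or.inl (lt_of_le_of_ne h fun e => e2 (by linarith))
      · exact Or.inr (lt_of_le_of_ne h fun e => e1 (by linarith))
    have h910' : 0 < 3 / 2 * x + 1 - 11 / 5 ∨ 0 < -(3 / 2) * x + 1 + 1 / 20 := by
      rcases h910 with h | h
      · exact Or.inl (lt_of_le_of_ne h fun e => e4 (by linarith))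
      · exact Or.inr (lt_of_le_of_ne h fun e => e3 (by linarith))
    refine Or.inr ⟨⟨0, 1⟩, by simp [Complex.ext_iff], fun ⟨u, w⟩ hv => ?_⟩
    norm_num [dot] at hv
    rw [tileFormula_edgePos_iff]
    exact ⟨⟨Or.inl (by linarith), Or.inl (Or.inl (by linarith))⟩, Or.inl (Or.inl (by linarith)),
        ⟨Or.inr ⟨by linarith, by linarith⟩, h78'.imp Or.inl Or.inl, h910'.imp Or.inl Or.inl⟩, Or.inl (Or.inl (by linarith))⟩
  · by_cases hc : 0 < 3 / 2 * x + y - 29 / 20 ∨ 0 < -(3 / 2) * x + y - 7 / 10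
    · have hd := fun h' => h ⟨by linarith, hc, h'⟩
      have h9 : 3 / 2 * x + y - 11 / 5 ≤ 0 := not_lt.1 fun h' => hd (Or.inl h')
      have h10 : -(3 / 2) * x + y + 1 / 20 ≤ 0 := not_lt.1 fun h' => hd (Or.inr h')
      rcases h910 with h' | h'
      · refine Or.inr ⟨⟨3 / 2, 1⟩, by simp [Complex.ext_iff], fun ⟨u, w⟩ hv => ?_⟩
        norm_num [dot] at hv
        rw [tileFormula_edgePos_iff]
        exact ⟨⟨Or.inl (by linarith), Or.inl (Or.inl (by linarith))⟩, Or.inl (Or.inl (by linarith)),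
        ⟨Or.inl (by linarith), Or.inl (Or.inl (by linarith)), Or.inl (Or.inr ⟨by linarith, by linarith⟩)⟩, Or.inl (Or.inl (by linarith))⟩
      · refine Or.inr ⟨⟨-(3 / 2), 1⟩, by simp [Complex.ext_iff], fun ⟨u, w⟩ hv => ?_⟩
        norm_num [dot] at hv
        rw [tileFormula_edgePos_iff]
        exact ⟨⟨Or.inl (by linarith), Or.inl (Or.inl (by linarith))⟩, Or.inl (Or.inl (by linarith)),
        ⟨Or.inl (by linarith), Or.inl (Or.inl (by linarith)), Or.inr (Or.inr ⟨by linarith, by linarith⟩)⟩, Or.inl (Or.inl (by linarith))⟩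
    · have h7 : 3 / 2 * x + y - 29 / 20 ≤ 0 := not_lt.1 fun h' => hc (Or.inl h')
      have h8 : -(3 / 2) * x + y - 7 / 10 ≤ 0 := not_lt.1 fun h' => hc (Or.inr h')
      rcases h78 with h' | h'
      · refine Or.inr ⟨⟨3 / 2, 1⟩, by simp [Complex.ext_iff], fun ⟨u, w⟩ hv => ?_⟩
        norm_num [dot] at hv
        rw [tileFormula_edgePos_iff]
        exact ⟨⟨Or.inl (by linarith), Or.inl (Or.inl (by linarith))⟩, Or.inl (Or.inl (by linarith)),
        ⟨Or.inl (by linarith), Or.inl (Or.inr ⟨by linarith, by linarith⟩), Or.inr (Or.inl (by linarith))⟩, Or.inl (Or.inl (by linarith))⟩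
      · refine Or.inr ⟨⟨-(3 / 2), 1⟩, by simp [Complex.ext_iff], fun ⟨u, w⟩ hv => ?_⟩
        norm_num [dot] at hv
        rw [tileFormula_edgePos_iff]
        exact ⟨⟨Or.inl (by linarith), Or.inl (Or.inl (by linarith))⟩, Or.inl (Or.inl (by linarith)),
        ⟨Or.inl (by linarith), Or.inr (Or.inr ⟨by linarith, by linarith⟩), Or.inr (Or.inl (by linarith))⟩, Or.inl (Or.inl (by linarith))⟩

theorem hasVertexOrHalfPlane_of_top {x y : ℝ} (hz : TileFormula fun i => 0 ≤ edgeValue ⟨x, y⟩ i)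
    (h : ¬(0 < 2 - y ∨ 0 < -(3 / 2) * x - y + 29 / 10 ∧ 0 < 3 / 2 * x - y + 7 / 5)) :
    HasVertexOrHalfPlane ⟨x, y⟩ := by
  rw [tileFormula_edgeValue_iff] at hz
  obtain ⟨⟨h0, -⟩, h345, -, h11⟩ := hz
  have hy : 2 ≤ y := not_lt.1 fun h' => h (Or.inl (by linarith))
  rcases hy.eq_or_lt with rfl | hy
  · have hx1 : x ≤ 1 := by rcases h345 with h | ⟨-, h⟩ <;> linarith
    rcases h0.eq_or_lt with rfl | h0
    · exact Or.inl ⟨_, _, .topLeft⟩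
    rcases hx1.eq_or_lt with rfl | hx1
    · exact Or.inl ⟨_, _, .topRight⟩
    refine Or.inr ⟨⟨0, -1⟩, by simp [Complex.ext_iff], fun ⟨u, w⟩ hv => ?_⟩
    norm_num [dot] at hv
    rw [tileFormula_edgePos_iff]
    exact ⟨⟨Or.inl (by linarith), Or.inr (Or.inl (by linarith))⟩, Or.inl (Or.inl (by linarith)),
        ⟨Or.inl (by linarith), Or.inl (Or.inl (by linarith)), Or.inr (Or.inl (by linarith))⟩, Or.inl (Or.inr ⟨by linarith, by linarith⟩)⟩
  · obtain ⟨h12, h13⟩ : 0 ≤ -(3 / 2) * x - y + 29 / 10 ∧ 0 ≤ 3 / 2 * x - y + 7 / 5 :=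
      h11.resolve_left (by linarith)
    rcases h12.eq_or_lt with h12 | h12
    · rcases h13.eq_or_lt with h13 | h13
      · obtain rfl : x = 1 / 2 := by linarith
        obtain rfl : y = 43 / 20 := by linarith
        exact Or.inl ⟨_, _, .topApex⟩
      · refine Or.inr ⟨⟨-(3 / 2), -1⟩, by simp [Complex.ext_iff], fun ⟨u, w⟩ hv => ?_⟩
        norm_num [dot] at hv
        rw [tileFormula_edgePos_iff]
        exact ⟨⟨Or.inl (by linarith), Or.inr (Or.inl (by linarith))⟩, Or.inl (Or.inl (by linarith)),
        ⟨Or.inl (by linarith), Or.inl (Or.inl (by linarith)), Or.inr (Or.inl (by linarith))⟩, Or.inr (⟨Or.inr ⟨by linarith, by linarith⟩, Or.inl (by linarith)⟩)⟩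
    · have h13' : 3 / 2 * x - y + 7 / 5 = 0 :=
        le_antisymm (not_lt.1 fun h' => h (Or.inr ⟨h12, h'⟩)) h13
      refine Or.inr ⟨⟨3 / 2, -1⟩, by simp [Complex.ext_iff], fun ⟨u, w⟩ hv => ?_⟩
      norm_num [dot] at hv
      rw [tileFormula_edgePos_iff]
      exact ⟨⟨Or.inl (by linarith), Or.inr (Or.inl (by linarith))⟩, Or.inl (Or.inl (by linarith)),
        ⟨Or.inl (by linarith), Or.inl (Or.inl (by linarith)), Or.inr (Or.inl (by linarith))⟩, Or.inr (⟨Or.inl (by linarith), Or.inr ⟨by linarith, by linarith⟩⟩)⟩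

/-- A tight side decides; if none is tight, every direction leads inside. Reentrant vertices fall
under the half-plane alternative. -/
theorem hasVertexOrHalfPlane {z : ℂ} (hz : z ∈ tileRegion) : HasVertexOrHalfPlane z := by
  obtain ⟨x, y⟩ := z
  rw [mem_tileRegion] at hz
  by_cases h1 : 0 < x ∧ (0 < x - 3 / 4 * y + 15 / 16 ∨ 0 < x + 3 * y - 9 / 2)
  swap
  · exact hasVertexOrHalfPlane_of_left hz h1
  by_cases h2 : 0 < 1 - x ∨ 0 < -x + 3 / 4 * y + 1 / 16 ∧ 0 < -x - 3 * y + 11 / 2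
  swap
  · exact hasVertexOrHalfPlane_of_right hz h2
  by_cases h3 : 0 < y - 1 ∧ (0 < 3 / 2 * x + y - 29 / 20 ∨ 0 < -(3 / 2) * x + y - 7 / 10) ∧
      (0 < 3 / 2 * x + y - 11 / 5 ∨ 0 < -(3 / 2) * x + y + 1 / 20)
  swap
  · exact hasVertexOrHalfPlane_of_bottom hz h3
  by_cases h4 : 0 < 2 - y ∨ 0 < -(3 / 2) * x - y + 29 / 10 ∧ 0 < 3 / 2 * x - y + 7 / 5
  swap
  · exact hasVertexOrHalfPlane_of_top hz h4
  refine Or.inr ⟨1, one_ne_zero, fun v _ => ?_⟩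
  have h : TileFormula fun i => 0 < edgeValue ⟨x, y⟩ i := ⟨h1, h2, h3, h4⟩
  exact h.mono fun i hi => Or.inl hi

/-- The reentrant vertices of the tile at which a neighbour is forced, with the two edge directions
bounding the complement of the tile. -/
inductive ReentrantVertex : ℂ → ℂ → ℂ → Prop
  | firstChild : ReentrantVertex ⟨1 / 4, 43 / 40⟩ ⟨-2, -3⟩ ⟨2, -3⟩
  | secondChild : ReentrantVertex ⟨3 / 4, 43 / 40⟩ ⟨-2, -3⟩ ⟨2, -3⟩
  | left : ReentrantVertex ⟨3 / 20, 29 / 20⟩ ⟨-3, 1⟩ ⟨-3, -4⟩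
  | right : ReentrantVertex ⟨1, 3 / 2⟩ ⟨3, -1⟩ ⟨0, 1⟩
  | topFirst : ReentrantVertex ⟨2 / 5, 2⟩ ⟨2, 3⟩ ⟨-1, 0⟩
  | topSecond : ReentrantVertex ⟨3 / 5, 2⟩ ⟨1, 0⟩ ⟨-2, 3⟩

theorem ReentrantVertex.cross_pos {p e e' : ℂ} (h : ReentrantVertex p e e') : 0 < cross e e' := by
  cases h <;> norm_num [cross]

theorem ReentrantVertex.edgePos {p e e' v : ℂ} (h : ReentrantVertex p e e')
    (hv : ¬(0 ≤ cross e v ∧ 0 ≤ cross v e')) : TileFormula (EdgePos p v) := by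
  obtain ⟨u, w⟩ := v
  rw [not_and_or, not_le, not_le] at hv
  cases h <;> norm_num [cross] at hv <;> rw [tileFormula_edgePos_iff] <;>
    norm_num [LexPos] <;> rcases hv with hv | hv <;>
    first | (left; linarith) | (right; linarith)

theorem ReentrantVertex.of_edgeNonneg {p e e' v : ℂ} (h : ReentrantVertex p e e')
    (hv : TileFormula (EdgeNonneg p v)) : ¬(0 < cross e v ∧ 0 < cross v e') := by
  obtain ⟨u, w⟩ := v
  rintro ⟨h1, h2⟩
  cases h <;> rw [tileFormula_edgeNonneg_iff] at hv <;> norm_num [LexNonneg] at hv <;>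
    norm_num [cross] at h1 h2 <;> rcases hv with hv | hv <;> linarith

/-- The complement of the tile at a reentrant vertex is a wedge of moderate angle. -/
theorem ReentrantVertex.exists_axis {p e e' : ℂ} (h : ReentrantVertex p e e') :
    ∃ u, 0 < cross e u ∧ 0 < cross u e' ∧ ∀ v, 0 ≤ cross e v → 0 ≤ cross v e' →
      |cross u v| ≤ 23 / 10 * dot u v := by
  -- The axes are bisectors or rational approximations of them. The constant `23 / 10` lies below
  -- `12 / 5`, the tangent of twice the half-angle `arctan (2 / 3)` of the top bump.
  cases h
  · refine ⟨⟨0, -1⟩, ?_, ?_, ?_⟩ <;> norm_num [cross, dot, abs_le]; intros; constructor <;> linarith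
  · refine ⟨⟨0, -1⟩, ?_, ?_, ?_⟩ <;> norm_num [cross, dot, abs_le]; intros; constructor <;> linarith
  · refine ⟨⟨-16, -5⟩, ?_, ?_, ?_⟩ <;> norm_num [cross, dot, abs_le]; intros; constructor <;> linarith
  · refine ⟨⟨25, 18⟩, ?_, ?_, ?_⟩ <;> norm_num [cross, dot, abs_le]; intros; constructor <;> linarith
  · refine ⟨⟨-8, 15⟩, ?_, ?_, ?_⟩ <;> norm_num [cross, dot, abs_le]; intros; constructor <;> linarith
  · refine ⟨⟨8, 15⟩, ?_, ?_, ?_⟩ <;> norm_num [cross, dot, abs_le]; intros; constructor <;> linarith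

/-- The angle of the tile at a convex vertex is at least that of the top bump. -/
theorem TileVertex.exists_axis {q a a' : ℂ} (h : TileVertex q a a') :
    ∃ s : ℂ, s ≠ 0 ∧ ∀ v, 3 * |cross s v| < 2 * dot s v → 0 < cross a v ∧ 0 < cross v a' := by
  -- The sector about `s` has half-angle `arctan (2 / 3)`, exactly that of the top apex; the axes
  -- below again bisect the angles, up to rational approximation.
  have key : ∀ s v : ℂ, 3 * |cross s v| < 2 * dot s v →
      3 * cross s v < 2 * dot s v ∧ -(2 * dot s v) < 3 * cross s v := fun s v hv =>
    ⟨by linarith [le_abs_self (cross s v)], by linarith [neg_le_abs (cross s v)]⟩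
  cases h
  · refine ⟨⟨0, -1⟩, by simp [Complex.ext_iff], fun v hv => ?_⟩
    have := key _ _ hv
    norm_num [cross, dot] at this ⊢
    constructor <;> linarith
  · refine ⟨⟨-16, -5⟩, by simp [Complex.ext_iff], fun v hv => ?_⟩
    have := key _ _ hv
    norm_num [cross, dot] at this ⊢
    constructor <;> linarith
  · refine ⟨⟨1, 1⟩, by simp [Complex.ext_iff], fun v hv => ?_⟩
    have := key _ _ hv
    norm_num [cross, dot] at this ⊢
    constructor <;> linarith
  · refine ⟨⟨-1, 1⟩, by simp [Complex.ext_iff], fun v hv => ?_⟩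
    have := key _ _ hv
    norm_num [cross, dot] at this ⊢
    constructor <;> linarith
  · refine ⟨⟨-1, -1⟩, by simp [Complex.ext_iff], fun v hv => ?_⟩
    have := key _ _ hv
    norm_num [cross, dot] at this ⊢
    constructor <;> linarith
  · refine ⟨⟨1, -1⟩, by simp [Complex.ext_iff], fun v hv => ?_⟩
    have := key _ _ hv
    norm_num [cross, dot] at this ⊢
    constructor <;> linarith
  · refine ⟨⟨25, 18⟩, by simp [Complex.ext_iff], fun v hv => ?_⟩
    have := key _ _ hv
    norm_num [cross, dot] at this ⊢
    constructor <;> linarith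
  · refine ⟨⟨3, -1⟩, by simp [Complex.ext_iff], fun v hv => ?_⟩
    have := key _ _ hv
    norm_num [cross, dot] at this ⊢
    constructor <;> linarith
  · refine ⟨⟨-8, 15⟩, by simp [Complex.ext_iff], fun v hv => ?_⟩
    have := key _ _ hv
    norm_num [cross, dot] at this ⊢
    constructor <;> linarith
  · refine ⟨⟨8, 15⟩, by simp [Complex.ext_iff], fun v hv => ?_⟩
    have := key _ _ hv
    norm_num [cross, dot] at this ⊢
    constructor <;> linarith
  · refine ⟨⟨-8, 15⟩, by simp [Complex.ext_iff], fun v hv => ?_⟩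
    have := key _ _ hv
    norm_num [cross, dot] at this ⊢
    constructor <;> linarith
  · refine ⟨⟨8, 15⟩, by simp [Complex.ext_iff], fun v hv => ?_⟩
    have := key _ _ hv
    norm_num [cross, dot] at this ⊢
    constructor <;> linarith

end HypPacking

namespace HypPacking

open Filter Topology

/-! ### Matching of cones -/

theorem cross_mul_left (c a b : ℂ) : cross (c * a) (c * b) = Complex.normSq c * cross a b := by
  simp only [cross, Complex.mul_re, Complex.mul_im, Complex.normSq_apply]
  ring

theorem dot_mul_left (c a b : ℂ) : dot (c * a) (c * b) = Complex.normSq c * dot a b := by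
  simp only [dot, Complex.mul_re, Complex.mul_im, Complex.normSq_apply]
  ring

theorem continuous_cross_right (a : ℂ) : Continuous fun v => cross a v := by
  unfold cross; fun_prop

theorem continuous_cross_left (a : ℂ) : Continuous fun v => cross v a := by
  unfold cross; fun_prop

theorem isClosed_cone (a a' : ℂ) : IsClosed {v | 0 ≤ cross a v ∧ 0 ≤ cross v a'} :=
  (isClosed_le continuous_const (continuous_cross_right a)).inter
    (isClosed_le continuous_const (continuous_cross_left a'))

/-- The edges of an open convex cone are limits of its elements. -/
theorem mem_closed_of_cone_subset {a a' : ℂ} (h : 0 < cross a a') {C : Set ℂ} (hC : IsClosed C)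
    (hsub : ∀ v, 0 < cross a v → 0 < cross v a' → v ∈ C) : a ∈ C ∧ a' ∈ C := by
  have hlim : ∀ b b' : ℂ, Tendsto (fun t : ℝ => b + t * b') (𝓝[>] 0) (𝓝 b) := fun b b' => by
    have : Continuous fun t : ℝ => b + t * b' := by fun_prop
    simpa using (this.tendsto 0).mono_left nhdsWithin_le_nhds
  constructor
  · refine hC.mem_of_tendsto (hlim a a') ?_
    filter_upwards [self_mem_nhdsWithin] with t ht
    refine hsub _ ?_ ?_
    · have : cross a (a + t * a') = t * cross a a' := by simp [cross]; ring
      rw [this]; exact mul_pos ht h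
    · have : cross (a + t * a') a' = cross a a' := by simp [cross]; ring
      rwa [this]
  · refine hC.mem_of_tendsto (hlim a' a) ?_
    filter_upwards [self_mem_nhdsWithin] with t ht
    refine hsub _ ?_ ?_
    · have : cross a (a' + t * a) = cross a a' := by simp [cross]; ring
      rwa [this]
    · have : cross (a' + t * a) a' = t * cross a a' := by simp [cross]; ring
      rw [this]; exact mul_pos ht h

theorem eq_zero_of_cross_eq_zero {a a' v : ℂ} (h : cross a a' ≠ 0) (h1 : cross a v = 0)
    (h2 : cross v a' = 0) : v = 0 := by
  simp only [cross] at h h1 h2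
  apply Complex.ext
  · have : v.re * (a.re * a'.im - a.im * a'.re) = 0 := by linear_combination a.re * h2 + a'.re * h1
    simpa [h] using this
  · have : v.im * (a.re * a'.im - a.im * a'.re) = 0 := by linear_combination a.im * h2 + a'.im * h1
    simpa [h] using this

theorem exists_pos_mul_eq {a b c : ℂ} (h0 : cross a b = 0) (ha : 0 < cross a c)
    (hb : 0 < cross b c) : ∃ r : ℝ, 0 < r ∧ b = r * a := by
  refine ⟨cross b c / cross a c, div_pos hb ha, ?_⟩
  have hac : cross a c ≠ 0 := ha.ne'
  simp only [cross] at *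
  apply Complex.ext
  · rw [Complex.re_ofReal_mul]
    rw [div_mul_eq_mul_div, eq_div_iff hac]
    linear_combination c.re * h0
  · rw [Complex.im_ofReal_mul]
    rw [div_mul_eq_mul_div, eq_div_iff hac]
    linear_combination c.im * h0

/-- If a multiple of a convex cone coincides with another one, up to the boundary, then the edges
correspond. -/
theorem exists_pos_of_cone_eq {a a' e e' c : ℂ} (ha : 0 < cross a a') (he : 0 < cross e e')
    (h1 : ∀ v, 0 < cross a v → 0 < cross v a' → 0 ≤ cross e (c * v) ∧ 0 ≤ cross (c * v) e')
    (h2 : ∀ v, 0 < cross e (c * v) → 0 < cross (c * v) e' → 0 ≤ cross a v ∧ 0 ≤ cross v a')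
    (hc : c ≠ 0) :
    (∃ r : ℝ, 0 < r ∧ c * a = r * e) ∧ ∃ r : ℝ, 0 < r ∧ c * a' = r * e' := by
  have hn : 0 < Complex.normSq c := Complex.normSq_pos.2 hc
  have hmul : Continuous fun v : ℂ => c * v := by fun_prop
  obtain ⟨⟨a1, a2⟩, a3, a4⟩ := mem_closed_of_cone_subset ha
    ((isClosed_cone e e').preimage hmul) fun v hv hv' => h1 v hv hv'
  obtain ⟨⟨e1, e2⟩, e3, e4⟩ := mem_closed_of_cone_subset he
    ((isClosed_cone (c * a) (c * a'))) fun v hv hv' => by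
      have h := h2 (c⁻¹ * v) (by rwa [mul_inv_cancel_left₀ hc]) (by rwa [mul_inv_cancel_left₀ hc])
      have k1 : cross (c * a) v = Complex.normSq c * cross a (c⁻¹ * v) := by
        rw [← cross_mul_left, mul_inv_cancel_left₀ hc]
      have k2 : cross v (c * a') = Complex.normSq c * cross (c⁻¹ * v) a' := by
        rw [← cross_mul_left, mul_inv_cancel_left₀ hc]
      exact ⟨k1 ▸ mul_nonneg hn.le h.1, k2 ▸ mul_nonneg hn.le h.2⟩
  have anti : ∀ x y : ℂ, cross x y = -cross y x := fun x y => by simp only [cross]; ring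
  have hca : 0 < cross (c * a) (c * a') := by rw [cross_mul_left]; exact mul_pos hn ha
  have f1 : cross e (c * a) = 0 := le_antisymm (by rw [anti]; linarith) a1
  have f2 : cross (c * a') e' = 0 := le_antisymm (by rw [anti]; linarith) a4
  have hce : c * a ≠ 0 := fun h => by simp [h, cross] at hca
  have hce' : c * a' ≠ 0 := fun h => by simp [h, cross] at hca
  have g1 : 0 < cross (c * a) e' :=
    lt_of_le_of_ne a2 fun h => hce (eq_zero_of_cross_eq_zero he.ne' f1 h.symm)
  have g2 : 0 < cross e (c * a') :=
    lt_of_le_of_ne a3 fun h => hce' (eq_zero_of_cross_eq_zero he.ne' h.symm f2)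
  refine ⟨exists_pos_mul_eq f1 he g1, exists_pos_mul_eq (c := -e) ?_ ?_ ?_⟩
  · rw [anti, f2, neg_zero]
  · have : cross e' (-e) = cross e e' := by simp [cross]; ring
    rwa [this]
  · have : cross (c * a') (-e) = cross e (c * a') := by simp [cross]; ring
    rwa [this]

theorem TileVertex.inwardCone {q : ℍ} {a a' v : ℂ} (h : TileVertex q a a') (h1 : 0 < cross a v)
    (h2 : 0 < cross v a') : v ∈ inwardCone binaryTile q :=
  mem_inwardCone_of_edgePos (h.edgePos h1 h2)

theorem TileVertex.of_contactCone {q : ℍ} {a a' v : ℂ} (h : TileVertex q a a')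
    (hv : v ∈ contactCone binaryTile q) : 0 ≤ cross a v ∧ 0 ≤ cross v a' :=
  h.of_edgeNonneg (edgeNonneg_of_mem_contactCone hv)

/-- The closure of a half-plane contains a line, whereas the closed cone between `e` and `e'`
contains none. -/
theorem not_halfPlane_subset_cone {c n e e' : ℂ} (hc : c ≠ 0) (hn : n ≠ 0) (he : 0 < cross e e')
    (h : ∀ v, 0 < dot n v → 0 ≤ cross e (c * v) ∧ 0 ≤ cross (c * v) e') : False := by
  have hmul : Continuous fun v : ℂ => c * v := by fun_prop
  have hcl := (isClosed_cone e e').preimage hmul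
  have hmem : ∀ w : ℂ, dot n w = 0 → w ∈ (fun v : ℂ => c * v) ⁻¹' {v | 0 ≤ cross e v ∧ 0 ≤ cross v e'} := by
    intro w hw
    have hlim : Tendsto (fun t : ℝ => w + t * n) (𝓝[>] 0) (𝓝 w) := by
      have : Continuous fun t : ℝ => w + t * n := by fun_prop
      simpa using (this.tendsto 0).mono_left nhdsWithin_le_nhds
    refine hcl.mem_of_tendsto hlim ?_
    filter_upwards [self_mem_nhdsWithin] with t ht
    refine h _ ?_
    have : dot n (w + t * n) = dot n w + t * Complex.normSq n := by
      simp [dot, Complex.normSq_apply]; ring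
    rw [this, hw, zero_add]
    exact mul_pos ht (Complex.normSq_pos.2 hn)
  obtain ⟨h1, h2⟩ := hmem (Complex.I * n) (by simp [dot]; ring)
  obtain ⟨h3, h4⟩ := hmem (-(Complex.I * n)) (by simp [dot]; ring)
  have k1 : cross e (c * -(Complex.I * n)) = -cross e (c * (Complex.I * n)) := by
    simp [cross]; ring
  have k2 : cross (c * -(Complex.I * n)) e' = -cross (c * (Complex.I * n)) e' := by
    simp [cross]; ring
  rw [k1] at h3
  rw [k2] at h4
  have h0 := eq_zero_of_cross_eq_zero he.ne' (le_antisymm (by linarith) h1)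
    (le_antisymm (by linarith) h2)
  simp [hc, hn] at h0

/-- If the cone at `p` of a copy of the tile is, up to the boundary, the convex cone spanned by `e`
and `e'`, then `p` is a convex vertex of this copy, and `e`, `e'` are its edges. -/
theorem exists_tileVertex_of_cone {h : SL(2, ℝ)} {p : ℍ} {e e' : ℂ} (he : 0 < cross e e')
    (hp : p ∈ h • binaryTile)
    (h1 : ∀ v ∈ inwardCone (h • binaryTile) p, 0 ≤ cross e v ∧ 0 ≤ cross v e')
    (h2 : ∀ v, 0 < cross e v → 0 < cross v e' → v ∈ contactCone (h • binaryTile) p) :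
    ∃ (q : ℍ) (a a' : ℂ), h • q = p ∧ TileVertex q a a' ∧
      (∃ r : ℝ, 0 < r ∧ slope h q * a = r * e) ∧ ∃ r : ℝ, 0 < r ∧ slope h q * a' = r * e' := by
  obtain ⟨q, hq, rfl⟩ := hp
  replace h1 : ∀ v ∈ inwardCone binaryTile q, 0 ≤ cross e (slope h q * v) ∧
      0 ≤ cross (slope h q * v) e' := fun v hv =>
    h1 _ ((slope_mul_mem_inwardCone_iff h).2 hv)
  replace h2 : ∀ v, 0 < cross e (slope h q * v) → 0 < cross (slope h q * v) e' →
      v ∈ contactCone binaryTile q := fun v hv hv' =>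
    (slope_mul_mem_contactCone_iff h).1 (h2 _ hv hv')
  rcases hasVertexOrHalfPlane ((mem_binaryTile_iff q).1 hq) with ⟨a, a', ha⟩ | ⟨n, hn, hn'⟩
  · exact ⟨q, a, a', rfl, ha, exists_pos_of_cone_eq ha.cross_pos he
      (fun v hv hv' => h1 v (ha.inwardCone hv hv'))
      (fun v hv hv' => ha.of_contactCone (h2 v hv hv')) (slope_ne_zero h q)⟩
  · exact (not_halfPlane_subset_cone (slope_ne_zero h q) hn he fun v hv =>
      h1 v (mem_inwardCone_of_edgePos (hn' v hv))).elim

/-- Every cone of a copy of the tile contains a sector with the angle of the top bump. -/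
theorem exists_sector_subset_inwardCone {h : SL(2, ℝ)} {p : ℍ} (hp : p ∈ h • binaryTile) :
    ∃ s : ℂ, s ≠ 0 ∧ ∀ v, 3 * |cross s v| < 2 * dot s v → v ∈ inwardCone (h • binaryTile) p := by
  obtain ⟨q, hq, rfl⟩ := hp
  obtain ⟨s, hs, hs'⟩ : ∃ s : ℂ, s ≠ 0 ∧ ∀ v, 3 * |cross s v| < 2 * dot s v →
      v ∈ inwardCone binaryTile q := by
    rcases hasVertexOrHalfPlane ((mem_binaryTile_iff q).1 hq) with ⟨a, a', ha⟩ | ⟨n, hn, hn'⟩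
    · obtain ⟨s, hs, hs'⟩ := ha.exists_axis
      exact ⟨s, hs, fun v hv => ha.inwardCone (hs' v hv).1 (hs' v hv).2⟩
    · refine ⟨n, hn, fun v hv => mem_inwardCone_of_edgePos (hn' v ?_)⟩
      linarith [abs_nonneg (cross n v)]
  have hc := slope_ne_zero h q
  refine ⟨slope h q * s, mul_ne_zero hc hs, fun v hv => ?_⟩
  obtain ⟨w, rfl⟩ : ∃ w, v = slope h q * w := ⟨(slope h q)⁻¹ * v, by rw [mul_inv_cancel_left₀ hc]⟩
  refine (slope_mul_mem_inwardCone_iff h).2 (hs' w ?_)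
  have hn : 0 < Complex.normSq (slope h q) := Complex.normSq_pos.2 hc
  rw [cross_mul_left, dot_mul_left, abs_mul, abs_of_pos hn] at hv
  nlinarith

/-- A sector with the angle of the top bump inside a wedge of moderate angle contains the axis of
the wedge. -/
theorem axis_mem_sector {s u : ℂ} (hs : s ≠ 0) (hu : u ≠ 0)
    (h : ∀ v, 3 * |cross s v| < 2 * dot s v → |cross u v| ≤ 23 / 10 * dot u v) :
    3 * |cross s u| < 2 * dot s u := by
  have hs0 : 0 < Complex.normSq s := Complex.normSq_pos.2 hs
  have hv : ∀ y : ℝ, |y| < 2 → |3 * cross u s + y * dot u s| ≤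
      23 / 10 * (3 * dot u s - y * cross u s) := by
    intro y hy
    have k1 : cross s (s * ⟨3, y⟩) = Complex.normSq s * y := by
      simp [cross, Complex.normSq_apply]; ring
    have k2 : dot s (s * ⟨3, y⟩) = Complex.normSq s * 3 := by
      simp [dot, Complex.normSq_apply]; ring
    have k3 : cross u (s * ⟨3, y⟩) = 3 * cross u s + y * dot u s := by
      simp [cross, dot]; ring
    have k4 : dot u (s * ⟨3, y⟩) = 3 * dot u s - y * cross u s := by
      simp [cross, dot]; ring
    rw [← k3, ← k4]
    refine h _ ?_
    rw [k1, k2, abs_mul, abs_of_pos hs0]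
    nlinarith
  -- The endpoints `±2` of the open sector are not available; since `23 / 10 < 12 / 5` leaves room,
  -- `±199 / 100` suffice.
  have h1 := abs_le.1 (hv (199 / 100) (by rw [abs_of_pos] <;> norm_num))
  have h2 := abs_le.1 (hv (-(199 / 100)) (by rw [abs_neg, abs_of_pos] <;> norm_num))
  have e1 : cross s u = -cross u s := by simp only [cross]; ring
  have e2 : dot s u = dot u s := by simp only [dot]; ring
  have hX : dot u s ≠ 0 := by
    intro h0
    have hY : cross u s = 0 := by
      rw [h0] at h1 h2
      linarith [h1.1, h1.2, h2.1, h2.2]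
    have h3 : Complex.normSq u * Complex.normSq s = dot u s ^ 2 + cross u s ^ 2 := by
      simp only [dot, cross, Complex.normSq_apply]; ring
    rw [h0, hY] at h3
    have := mul_pos (Complex.normSq_pos.2 hu) hs0
    norm_num at h3
    rcases h3 with h3 | h3
    · exact hu h3
    · exact hs h3
  have hX0 : 0 ≤ dot u s := by linarith [h1.2, h2.1]
  have hX1 : 0 < dot u s := lt_of_le_of_ne hX0 hX.symm
  rw [e1, e2, abs_neg]
  rcases abs_cases (cross u s) with ⟨h, -⟩ | ⟨h, -⟩ <;> rw [h] <;> linarith [h1.2, h2.1]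

/-! ### Forced neighbours -/

variable {T : PackingSpace {binaryTile}}

theorem eq_of_mem_cones {g h : SL(2, ℝ)} (hg : g • binaryTile ∈ T.bodies)
    (hh : h • binaryTile ∈ T.bodies) {p : ℍ} {v : ℂ} (h1 : v ∈ inwardCone (g • binaryTile) p)
    (h2 : v ∈ contactCone (h • binaryTile) p) : g • binaryTile = h • binaryTile := by
  obtain ⟨x, hx, hx'⟩ := interior_inter_nonempty_of_mem_cones h1 h2
  exact PackingSpace.eq_of_mem_interior_of_mem isBody_binaryTile hg hh hx hx'

/-- The complement of a tile at a reentrant vertex is filled by a convex vertex of a single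
neighbour. -/
theorem ReentrantVertex.exists_neighbour {p : ℍ} {e e' : ℂ} (h : ReentrantVertex p e e')
    (hT : T ∈ tilings {binaryTile}) (hβ : binaryTile ∈ T.bodies) :
    ∃ (k : SL(2, ℝ)) (q : ℍ) (a a' : ℂ), k • binaryTile ∈ T.bodies ∧ k • q = p ∧
      TileVertex q a a' ∧ (∃ r : ℝ, 0 < r ∧ slope k q * a = r * e) ∧
      ∃ r : ℝ, 0 < r ∧ slope k q * a' = r * e' := by
  obtain ⟨u, hu, hu', haxis⟩ := h.exists_axis
  have hu0 : u ≠ 0 := fun h0 => by simp [h0, cross] at hu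
  have hβ1 : (1 : SL(2, ℝ)) • binaryTile ∈ T.bodies := by rwa [one_smul]
  have hne : ∀ g : SL(2, ℝ), ∀ v ∈ contactCone (g • binaryTile) p, 0 < cross e v →
      0 < cross v e' → g • binaryTile ≠ binaryTile := by
    intro g v hv h1 h2 heq
    rw [heq] at hv
    exact h.of_edgeNonneg (edgeNonneg_of_mem_contactCone hv) ⟨h1, h2⟩
  have hsub : ∀ g : SL(2, ℝ), g • binaryTile ∈ T.bodies → g • binaryTile ≠ binaryTile →
      ∀ v ∈ contactCone (g • binaryTile) p, 0 ≤ cross e v ∧ 0 ≤ cross v e' := by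
    intro g hg hgne v hv
    by_contra hcon
    have hin : v ∈ inwardCone ((1 : SL(2, ℝ)) • binaryTile) p := by
      rw [one_smul]
      exact mem_inwardCone_of_edgePos (h.edgePos hcon)
    have := eq_of_mem_cones hβ1 hg hin hv
    rw [one_smul] at this
    exact hgne this.symm
  -- The key to uniqueness: every other tile at `p` has the axis of the gap in its inward cone, so
  -- no two distinct ones fit.
  have hin : ∀ g : SL(2, ℝ), g • binaryTile ∈ T.bodies → g • binaryTile ≠ binaryTile →
      p ∈ g • binaryTile → u ∈ inwardCone (g • binaryTile) p := by
    intro g hg hgne hp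
    obtain ⟨s, hs, hs'⟩ := exists_sector_subset_inwardCone hp
    refine hs' u (axis_mem_sector hs hu0 fun v hv => ?_)
    have := hsub g hg hgne v (inwardCone_subset_contactCone _ _ (hs' v hv))
    exact haxis v this.1 this.2
  obtain ⟨k, hk, hkp, hku⟩ := exists_mem_contactCone isBody_binaryTile hT p u
  have hkne := hne k u hku hu hu'
  obtain ⟨q, a, a', h1, h2, h3, h4⟩ := exists_tileVertex_of_cone h.cross_pos hkp
    (fun v hv => hsub k hk hkne v (inwardCone_subset_contactCone _ _ hv)) fun v hv hv' => by
      obtain ⟨g, hg, hgp, hgv⟩ := exists_mem_contactCone isBody_binaryTile hT p v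
      have hgne := hne g v hgv hv hv'
      rw [eq_of_mem_cones hk hg (hin k hk hkne hkp)
        (inwardCone_subset_contactCone _ _ (hin g hg hgne hgp))]
      exact hgv
  exact ⟨k, q, a, a', hk, h1, h2, h3, h4⟩

/-- Conformality: the two angles agree, stated without division so that vertices can be told apart
numerically. -/
theorem cross_mul_dot_eq {a a' e e' c : ℂ} (hc : c ≠ 0)
    (h : ∃ r : ℝ, 0 < r ∧ c * a = r * e) (h' : ∃ r : ℝ, 0 < r ∧ c * a' = r * e') :
    cross a a' * dot e e' = dot a a' * cross e e' := by
  obtain ⟨r, hr, h⟩ := h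
  obtain ⟨r', hr', h'⟩ := h'
  have hn := (Complex.normSq_pos.2 hc).ne'
  have k1 : Complex.normSq c * cross a a' = r * r' * cross e e' := by
    rw [← cross_mul_left, h, h']
    simp [cross]; ring
  have k2 : Complex.normSq c * dot a a' = r * r' * dot e e' := by
    rw [← dot_mul_left, h, h']
    simp [dot]; ring
  apply mul_left_cancel₀ hn
  linear_combination dot e e' * k1 - cross e e' * k2

/-- The derivative is the inverse square of the denominator. If it is positive, the denominator is
real at a point off the real axis, so its leading coefficient vanishes and `h` fixes `∞`. -/
theorem apply_one_zero_eq_zero_of_slope {h : SL(2, ℝ)} {q : ℍ} {r : ℝ} (hr : 0 < r)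
    (hs : slope h q = r) : h 1 0 = 0 := by
  have h1 : den h q ^ 2 = ((r⁻¹ : ℝ) : ℂ) := by
    rw [Complex.ofReal_inv, ← hs, slope, inv_inv]
  have hre : (den h q).re = h 1 0 * q.re + h 1 1 := by simp [den]
  have him : (den h q).im = h 1 0 * q.im := by simp [den]
  have h2 := congrArg Complex.re h1
  have h3 := congrArg Complex.im h1
  simp only [sq, Complex.mul_re, Complex.mul_im, Complex.ofReal_re, Complex.ofReal_im] at h2 h3
  have hr' : 0 < r⁻¹ := inv_pos.2 hr
  have h4 : (den h q).re ≠ 0 := by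
    intro h0
    rw [h0] at h2
    nlinarith [mul_self_nonneg (den h q).im]
  have h5 : (den h q).im = 0 := by
    have : (den h q).re * (den h q).im = 0 := by linarith
    exact (mul_eq_zero.1 this).resolve_left h4
  rw [him] at h5
  exact (mul_eq_zero.1 h5).resolve_right q.im_pos.ne'

/-- A map fixing `∞` is real affine, and the image of one nonreal point determines both
coefficients. -/
theorem smul_eq_smul_of_apply_one_zero {h k : SL(2, ℝ)} (hh : h 1 0 = 0) (hk : k 1 0 = 0) {q : ℍ}
    (hq : h • q = k • q) (z : ℍ) : h • z = k • z := by
  have key : ∀ g : SL(2, ℝ), g 1 0 = 0 → ∀ w : ℍ,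
      ((g • w : ℍ) : ℂ) = ((g 0 0 ^ 2 : ℝ) : ℂ) * w + ((g 0 0 * g 0 1 : ℝ) : ℂ) := by
    intro g hg w
    have hd := det_eq_one g
    rw [hg, mul_zero, sub_zero] at hd
    have hd' : (g 0 0 : ℂ) * g 1 1 = 1 := by exact_mod_cast hd
    have h11 : (g 1 1 : ℂ) ≠ 0 := right_ne_zero_of_mul_eq_one hd'
    rw [coe_smul_eq, den, hg, Complex.ofReal_zero, zero_mul, zero_add, div_eq_iff h11]
    push_cast
    linear_combination (-(g 0 0 : ℂ) * w - g 0 1) * hd'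
  have h1 := congrArg ((↑) : ℍ → ℂ) hq
  rw [key h hh, key k hk] at h1
  have him := congrArg Complex.im h1
  have hre := congrArg Complex.re h1
  simp only [Complex.add_im, Complex.add_re, Complex.im_ofReal_mul, Complex.re_ofReal_mul,
    Complex.ofReal_im, Complex.ofReal_re, add_zero, coe_im, coe_re] at him hre
  have e1 : h 0 0 ^ 2 = k 0 0 ^ 2 := mul_right_cancel₀ q.im_pos.ne' him
  rw [e1] at hre
  have e2 : h 0 0 * h 0 1 = k 0 0 * k 0 1 := add_left_cancel hre
  ext
  rw [key h hh, key k hk, e1, e2]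

theorem gridMap_apply_one_zero (m k : ℤ) : gridMap m k 1 0 = 0 := by simp [gridMap]

theorem eq_ofReal_of_mul_eq {c a : ℂ} {r : ℝ} (ha : a ≠ 0) (h : c * a = r * a) : c = r :=
  mul_right_cancel₀ ha h

/-- The symmetries of the tile are trivial. -/
theorem eq_of_smul_binaryTile_eq {k : SL(2, ℝ)} (hk : k • binaryTile = binaryTile) :
    k 1 0 = 0 ∧ ∀ z : ℍ, k • z = z := by
  let p : ℍ := ⟨⟨1 / 2, 43 / 20⟩, by norm_num⟩
  have hv : TileVertex p ⟨-2, -3⟩ ⟨2, -3⟩ := .topApex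
  have hp : p ∈ k • binaryTile := by
    rw [hk, mem_binaryTile_iff, mem_tileRegion, tileFormula_edgeValue_iff]
    norm_num
  obtain ⟨q, a, a', hq, hvq, hr, hr'⟩ := exists_tileVertex_of_cone hv.cross_pos hp
    (fun v hv' => hv.of_contactCone (inwardCone_subset_contactCone _ _ (by rwa [hk] at hv')))
    fun v h1 h2 => by
      rw [hk]
      exact inwardCone_subset_contactCone _ _ (hv.inwardCone h1 h2)
  have hangle := cross_mul_dot_eq (slope_ne_zero k q) hr hr'
  -- No other convex vertex has the angle of the top apex, so a symmetry fixes the apex and its edge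
  -- directions.
  obtain ⟨hqp, ha⟩ : (q : ℂ) = p ∧ a = ⟨-2, -3⟩ := by
    generalize (q : ℂ) = w at hvq
    cases hvq <;> first | exact ⟨rfl, rfl⟩ | (exfalso; norm_num [cross, dot] at hangle)
  obtain rfl : q = p := UpperHalfPlane.ext hqp
  obtain ⟨r, hr0, hr⟩ := hr
  rw [ha] at hr
  have hk0 := apply_one_zero_eq_zero_of_slope hr0
    (eq_ofReal_of_mul_eq (by simp [Complex.ext_iff]) hr)
  refine ⟨hk0, fun z => ?_⟩
  have := smul_eq_smul_of_apply_one_zero (k := 1) hk0 (by simp) (q := p) (by rw [hq, one_smul]) z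
  rwa [one_smul] at this

/-- If the angle of the gap singles out one vertex `q₀` with first edge `e`, the derivative of the
neighbour there is a positive real. It then fixes `∞` and sends `q₀` where `gridMap m l` does. -/
theorem gridMap_smul_mem_bodies_of_vertex {p q₀ : ℍ} {e e' : ℂ} {m l : ℤ}
    (h : ReentrantVertex p e e') (hT : T ∈ tilings {binaryTile}) (hβ : binaryTile ∈ T.bodies)
    (hq₀ : gridMap m l • q₀ = p) (he : e ≠ 0)
    (huniq : ∀ q a a', TileVertex q a a' → cross a a' * dot e e' = dot a a' * cross e e' →
      q = q₀ ∧ a = e) : gridMap m l • binaryTile ∈ T.bodies := by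
  obtain ⟨k, q, a, a', hk, hkq, hvq, hr, hr'⟩ := h.exists_neighbour hT hβ
  obtain ⟨hq, rfl⟩ := huniq _ _ _ hvq (cross_mul_dot_eq (slope_ne_zero k q) hr hr')
  obtain rfl : q = q₀ := UpperHalfPlane.ext hq
  obtain ⟨r, hr0, hr⟩ := hr
  have hk0 := apply_one_zero_eq_zero_of_slope hr0 (eq_ofReal_of_mul_eq he hr)
  have heq := smul_eq_smul_of_apply_one_zero hk0 (gridMap_apply_one_zero m l) (hkq.trans hq₀.symm)
  have : k • binaryTile = gridMap m l • binaryTile := by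
    simp only [← Set.image_smul, heq]
  rwa [← this]

/-- The tip of a bottom dent can receive only a top apex; likewise, in `left_mem`, the tip of the
left dent only a side apex. -/
theorem firstChild_mem (hT : T ∈ tilings {binaryTile}) (hβ : binaryTile ∈ T.bodies) :
    gridMap (-1) 0 • binaryTile ∈ T.bodies := by
  refine gridMap_smul_mem_bodies_of_vertex (p := ⟨⟨1 / 4, 43 / 40⟩, by norm_num⟩)
    (q₀ := ⟨⟨1 / 2, 43 / 20⟩, by norm_num⟩) .firstChild hT hβ ?_ (by simp [Complex.ext_iff]) ?_
  · ext
    rw [coe_gridMap_smul]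
    apply Complex.ext <;> simp <;> norm_num
  · intro q a a' h hangle
    cases h <;> first | exact ⟨rfl, rfl⟩ | (exfalso; norm_num [cross, dot] at hangle)

theorem secondChild_mem (hT : T ∈ tilings {binaryTile}) (hβ : binaryTile ∈ T.bodies) :
    gridMap (-1) 1 • binaryTile ∈ T.bodies := by
  refine gridMap_smul_mem_bodies_of_vertex (p := ⟨⟨3 / 4, 43 / 40⟩, by norm_num⟩)
    (q₀ := ⟨⟨1 / 2, 43 / 20⟩, by norm_num⟩) .secondChild hT hβ ?_ (by simp [Complex.ext_iff]) ?_
  · ext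
    rw [coe_gridMap_smul]
    apply Complex.ext <;> simp <;> norm_num
  · intro q a a' h hangle
    cases h <;> first | exact ⟨rfl, rfl⟩ | (exfalso; norm_num [cross, dot] at hangle)

theorem left_mem (hT : T ∈ tilings {binaryTile}) (hβ : binaryTile ∈ T.bodies) :
    gridMap 0 (-1) • binaryTile ∈ T.bodies := by
  refine gridMap_smul_mem_bodies_of_vertex (p := ⟨⟨3 / 20, 29 / 20⟩, by norm_num⟩)
    (q₀ := ⟨⟨23 / 20, 29 / 20⟩, by norm_num⟩) .left hT hβ ?_ (by simp [Complex.ext_iff]) ?_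
  · ext
    rw [coe_gridMap_smul]
    apply Complex.ext <;> simp
    norm_num
  · intro q a a' h hangle
    cases h <;> first | exact ⟨rfl, rfl⟩ | (exfalso; norm_num [cross, dot] at hangle)

/-- At the tip of the right bump the gap exceeds a half-plane, so the upper foot is used; its angle
occurs only at the upper mouth of the left dent. -/
theorem right_mem (hT : T ∈ tilings {binaryTile}) (hβ : binaryTile ∈ T.bodies) :
    gridMap 0 1 • binaryTile ∈ T.bodies := by
  refine gridMap_smul_mem_bodies_of_vertex (p := ⟨⟨1, 3 / 2⟩, by norm_num⟩)
    (q₀ := ⟨⟨0, 3 / 2⟩, by norm_num⟩) .right hT hβ ?_ (by simp [Complex.ext_iff]) ?_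
  · ext
    rw [coe_gridMap_smul]
    apply Complex.ext <;> simp
  · intro q a a' h hangle
    cases h <;> first | exact ⟨rfl, rfl⟩ | (exfalso; norm_num [cross, dot] at hangle)

end HypPacking

namespace HypPacking

open Filter Topology

/-! ### Rigidity of the tilings -/

variable {T : PackingSpace {binaryTile}}

theorem binaryTile_mem_inv_smul {g : SL(2, ℝ)} (hg : g • binaryTile ∈ T.bodies) :
    binaryTile ∈ (g⁻¹ • T).bodies := by
  have : g⁻¹ • g • binaryTile ∈ g⁻¹ • T.bodies := Set.smul_mem_smul_set hg
  rwa [inv_smul_smul] at this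

theorem mul_smul_mem_bodies {g k : SL(2, ℝ)} (h : k • binaryTile ∈ (g⁻¹ • T).bodies) :
    (g * k) • binaryTile ∈ T.bodies := by
  replace h : k • binaryTile ∈ g⁻¹ • T.bodies := h
  rwa [Set.mem_smul_set_iff_inv_smul_mem, inv_inv, smul_smul] at h

theorem mul_child_mem (hT : T ∈ tilings {binaryTile}) {g : SL(2, ℝ)}
    (hg : g • binaryTile ∈ T.bodies) {l : ℤ} (hl : l = 0 ∨ l = 1) :
    (g * gridMap (-1) l) • binaryTile ∈ T.bodies := by
  rcases hl with rfl | rfl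
  · exact mul_smul_mem_bodies (firstChild_mem (smul_mem_tilings hT _) (binaryTile_mem_inv_smul hg))
  · exact mul_smul_mem_bodies (secondChild_mem (smul_mem_tilings hT _) (binaryTile_mem_inv_smul hg))

theorem mul_gridMap_zero_mem (hT : T ∈ tilings {binaryTile}) {g : SL(2, ℝ)}
    (hg : g • binaryTile ∈ T.bodies) (k : ℤ) : (g * gridMap 0 k) • binaryTile ∈ T.bodies := by
  induction k with
  | zero => rwa [gridMap_zero_zero, mul_one]
  | succ i ih =>
    rw [← gridMap_mul_gridMap_zero, ← mul_assoc]
    exact mul_smul_mem_bodies (right_mem (smul_mem_tilings hT _) (binaryTile_mem_inv_smul ih))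
  | pred i ih =>
    rw [sub_eq_add_neg, ← gridMap_mul_gridMap_zero, ← mul_assoc]
    exact mul_smul_mem_bodies (left_mem (smul_mem_tilings hT _) (binaryTile_mem_inv_smul ih))

theorem mul_gridMap_neg_mem (hT : T ∈ tilings {binaryTile}) {g : SL(2, ℝ)}
    (hg : g • binaryTile ∈ T.bodies) (n : ℕ) (k : ℤ) :
    (g * gridMap (-n) k) • binaryTile ∈ T.bodies := by
  induction n generalizing k with
  | zero => simpa using mul_gridMap_zero_mem hT hg k
  | succ n ih =>
    -- Column `k` is a child of column `k / 2` in the row above.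
    have := mul_child_mem hT (ih (k / 2)) (Int.emod_two_eq_zero_or_one k)
    rw [mul_assoc, gridMap_mul_gridMap_neg_one, Int.mul_ediv_add_emod] at this
    rwa [Nat.cast_succ, neg_add, ← sub_eq_add_neg]

/-- Two tiles of a packing with a common reentrant vertex coincide. -/
theorem ReentrantVertex.smul_eq_of_smul_eq {p q : ℍ} {e e' f f' : ℂ} (hp : ReentrantVertex p e e')
    (hq : ReentrantVertex q f f') (hβ : binaryTile ∈ T.bodies) {g : SL(2, ℝ)}
    (hg : g • binaryTile ∈ T.bodies) (hgq : g • q = p) : g • binaryTile = binaryTile := by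
  by_contra hne
  have hβ1 : (1 : SL(2, ℝ)) • binaryTile ∈ T.bodies := by rwa [one_smul]
  have hwedge : ∀ y, slope g q * y ∈ HypPacking.inwardCone binaryTile p →
      0 ≤ cross f y ∧ 0 ≤ cross y f' := by
    intro y hy
    by_contra hcon
    have hin := (slope_mul_mem_inwardCone_iff g).2 (mem_inwardCone_of_edgePos (hq.edgePos hcon))
    rw [hgq] at hin
    rw [← one_smul SL(2, ℝ) binaryTile] at hy
    have := eq_of_mem_cones hg hβ1 hin (inwardCone_subset_contactCone _ _ hy)
    rw [one_smul] at this
    exact hne this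
  have hc := slope_ne_zero g q
  have hpos := hp.cross_pos
  -- The opposite vectors `e - e'` and `e' - e` both lead inside `binaryTile`, so both would have to
  -- lie in the gap of the other tile, which contains no line.
  obtain ⟨y, hy⟩ : ∃ y, slope g q * y = e - e' :=
    ⟨(slope g q)⁻¹ * (e - e'), mul_inv_cancel_left₀ hc _⟩
  obtain ⟨h1, h2⟩ := hwedge y <| by
    rw [hy]
    refine mem_inwardCone_of_edgePos (hp.edgePos fun h => ?_)
    have : cross e (e - e') = -cross e e' := by simp [cross]; ring
    linarith [h.1]
  obtain ⟨h3, h4⟩ := hwedge (-y) <| by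
    rw [mul_neg, hy]
    refine mem_inwardCone_of_edgePos (hp.edgePos fun h => ?_)
    have : cross (-(e - e')) e' = -cross e e' := by simp [cross]; ring
    linarith [h.2]
  have k1 : cross f (-y) = -cross f y := by simp [cross]; ring
  have k2 : cross (-y) f' = -cross y f' := by simp [cross]; ring
  have hy0 : y = 0 := eq_zero_of_cross_eq_zero hq.cross_pos.ne' (by linarith) (by linarith)
  rw [hy0, mul_zero] at hy
  rw [← sub_eq_zero.1 hy.symm] at hpos
  simp [cross, mul_comm] at hpos

/-- A bottom dent of a tile lies at the foot of the bump of one of the tiles below it. -/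
theorem TileVertex.exists_reentrantVertex {q : ℍ} {a a' : ℂ} (h : TileVertex q a a')
    (hangle : cross a a' * -2 = dot a a' * 3) :
    ∃ (l : ℤ) (q' : ℍ) (f f' : ℂ), (l = 0 ∨ l = 1) ∧ ReentrantVertex q' f f' ∧
      gridMap (-1) l • q' = q := by
  have hfirst : ∀ l : ℤ, ((gridMap (-1) l • (⟨⟨2 / 5, 2⟩, by norm_num⟩ : ℍ) : ℍ) : ℂ) =
      ⟨1 / 5 + l / 2, 1⟩ := fun l => by
    rw [coe_gridMap_smul]
    apply Complex.ext <;> simp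
    ring
  have hsecond : ∀ l : ℤ, ((gridMap (-1) l • (⟨⟨3 / 5, 2⟩, by norm_num⟩ : ℍ) : ℍ) : ℂ) =
      ⟨3 / 10 + l / 2, 1⟩ := fun l => by
    rw [coe_gridMap_smul]
    apply Complex.ext <;> simp
    ring
  generalize hz : (q : ℂ) = z at h
  cases h
  case firstDent =>
    exact ⟨0, _, _, _, .inl rfl, .topFirst, UpperHalfPlane.ext (by
      rw [hfirst, hz]; norm_num)⟩
  case secondDent =>
    exact ⟨0, _, _, _, .inl rfl, .topSecond, UpperHalfPlane.ext (by
      rw [hsecond, hz]; norm_num)⟩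
  case thirdDent =>
    exact ⟨1, _, _, _, .inr rfl, .topFirst, UpperHalfPlane.ext (by
      rw [hfirst, hz]; norm_num)⟩
  case fourthDent =>
    exact ⟨1, _, _, _, .inr rfl, .topSecond, UpperHalfPlane.ext (by
      rw [hsecond, hz]; norm_num)⟩
  all_goals exfalso; norm_num [cross, dot] at hangle

/-- At a foot of the top bump, the angle leaves only the four mouths of bottom dents of the
neighbour `k`. Each is also a foot of the bump of a forced child of `k`; this child shares a
reentrant vertex with `binaryTile`, hence equals it. Symmetries being trivial, `k` acts as the
inverse of the child map. -/
theorem exists_parent_mem (hT : T ∈ tilings {binaryTile}) (hβ : binaryTile ∈ T.bodies) :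
    ∃ l : ℤ, (gridMap (-1) l)⁻¹ • binaryTile ∈ T.bodies := by
  have hp : ReentrantVertex (⟨⟨2 / 5, 2⟩, by norm_num⟩ : ℍ) ⟨2, 3⟩ ⟨-1, 0⟩ := .topFirst
  obtain ⟨k, q, a, a', hk, hkq, hvq, hr, hr'⟩ := hp.exists_neighbour hT hβ
  have hangle := cross_mul_dot_eq (slope_ne_zero k q) hr hr'
  obtain ⟨l, q', f, f', hl, hq', hlq⟩ := hvq.exists_reentrantVertex
    (by norm_num [cross, dot] at hangle ⊢; linarith)
  have heq := hp.smul_eq_of_smul_eq hq' hβ (mul_child_mem hT hk hl)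
    (by rw [mul_smul, hlq, hkq])
  have htriv := (eq_of_smul_binaryTile_eq heq).2
  refine ⟨l, ?_⟩
  have : k • binaryTile = (gridMap (-1) l)⁻¹ • binaryTile := by
    simp only [← Set.image_smul]
    refine Set.image_congr fun z _ => ?_
    rw [← htriv ((gridMap (-1) l)⁻¹ • z), mul_smul, smul_inv_smul]
  rwa [← this]

theorem direction_mul_of_apply_one_zero (g : SL(2, ℝ)) {k : SL(2, ℝ)} (hk : k 1 0 = 0) :
    direction (g * k) = direction g := by
  rw [direction_mul, direction_eq_ite k, if_pos hk]
  rfl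

/-- Ancestors of a tile point in the same direction and reach any height. -/
theorem exists_ancestor (hT : T ∈ tilings {binaryTile}) {g : SL(2, ℝ)}
    (hg : g • binaryTile ∈ T.bodies) (z : ℍ) (n : ℕ) :
    ∃ h : SL(2, ℝ), h • binaryTile ∈ T.bodies ∧ direction h = direction g ∧
      (h⁻¹ • z).im = (g⁻¹ • z).im / 2 ^ n := by
  induction n with
  | zero => exact ⟨g, hg, rfl, by simp⟩
  | succ n ih =>
    obtain ⟨h, hh, hd, him⟩ := ih
    obtain ⟨l, hl⟩ := exists_parent_mem (smul_mem_tilings hT h⁻¹) (binaryTile_mem_inv_smul hh)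
    refine ⟨_, mul_smul_mem_bodies hl, ?_, ?_⟩
    · rw [← hd, ← direction_mul_of_apply_one_zero _ (gridMap_apply_one_zero (-1) l),
        inv_mul_cancel_right]
    · rw [mul_inv_rev, inv_inv, mul_smul, pow_succ, ← div_div, ← him,
        ← im_gridMap_smul (-1) l (h⁻¹ • z), zpow_neg_one, div_inv_eq_mul,
        mul_div_cancel_right₀ _ (two_ne_zero' ℝ)]

/-- Take an ancestor of `g` so large that, seen from it, a point of `h • binaryTile` has height
below `1`. The forced rows below the ancestor cover that point, so `h • binaryTile` is one of their
tiles; all maps involved, including the leftover symmetry, fix `∞`. -/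
theorem isRigid_binaryTile : IsRigid binaryTile := by
  intro T hT g h hg hh
  obtain ⟨z, hz⟩ := (isBody_binaryTile.smul h).nonempty_interior
  obtain ⟨n, hn⟩ := pow_unbounded_of_one_lt (g⁻¹ • z).im (one_lt_two (α := ℝ))
  obtain ⟨g', hg', hd, him⟩ := exists_ancestor hT hg z n
  obtain ⟨m, k, hmem, hm⟩ := exists_mem_gridMap_smul (g'⁻¹ • z)
  have hm0 : m ≤ 0 := by
    have : (2 : ℝ) ^ m < 2 ^ (0 : ℤ) := by
      rw [zpow_zero]
      refine hm.trans_lt ?_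
      rwa [him, div_lt_one (by positivity)]
    exact ((zpow_lt_zpow_iff_right₀ (one_lt_two (α := ℝ))).1 this).le
  obtain ⟨j, rfl⟩ : ∃ j : ℕ, m = -j := ⟨m.natAbs, by omega⟩
  have hzmem : z ∈ (g' * gridMap (-j) k) • binaryTile := by
    rwa [mul_smul, Set.mem_smul_set_iff_inv_smul_mem]
  have heq := PackingSpace.eq_of_mem_interior_of_mem isBody_binaryTile hh
    (mul_gridMap_neg_mem hT hg' j k) hz hzmem
  have hstab : (h⁻¹ * (g' * gridMap (-j) k)) • binaryTile = binaryTile := by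
    rw [mul_smul, ← heq, inv_smul_smul]
  rw [← hd, ← direction_mul_of_apply_one_zero g' (gridMap_apply_one_zero (-j) k),
    ← direction_mul_of_apply_one_zero h (eq_of_smul_binaryTile_eq hstab).1, mul_inv_cancel_left]

end HypPacking

theorem mainTheorem5 :
    -- `β` is a body
    IsBody binaryTile ∧
    -- `β` tiles the hyperbolic plane
    (tilings {binaryTile}).Nonempty ∧
    -- sending a tiling to the point at infinity to which the protrusion of each of its tiles
    -- points is a continuous equivariant map from the tilings onto the circle at infinity
    (∃ f : tilings {binaryTile} → OnePoint ℝ,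
      (∀ (T : tilings {binaryTile}) (g : SL(2, ℝ)),
        g • binaryTile ∈ (T : PackingSpace {binaryTile}).bodies →
          f T = (g : GL (Fin 2) ℝ) • (∞ : OnePoint ℝ)) ∧
      Continuous f ∧ Function.Surjective f ∧
      ∀ (g : SL(2, ℝ)) (S T : tilings {binaryTile}),
        (S : PackingSpace {binaryTile}) = g • (T : PackingSpace {binaryTile}) →
          f S = (g : GL (Fin 2) ℝ) • f T) ∧
    -- the circle at infinity carries no invariant probability measure
    (¬ ∃ ν : Measure (OnePoint ℝ), IsInvariantAtInfinity ν) ∧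
    -- the tilings are a null set for every invariant measure
    (∀ μ ∈ invariantMeasures {binaryTile}, μ (tilings {binaryTile}) = 0) ∧
    -- the optimal density is less than one
    optimalDensity {binaryTile} < 1 := by
  exact ⟨isBody_binaryTile, tilings_binaryTile_nonempty,
    isRigid_binaryTile.exists_map isBody_binaryTile tilings_binaryTile_nonempty,
    not_exists_isInvariantAtInfinity,
    fun _ hμ => isRigid_binaryTile.measure_tilings_eq_zero isBody_binaryTile hμ,
    isRigid_binaryTile.optimalDensity_lt_one isBody_binaryTile⟩
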